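/- Graphs are finite and loopless but may have parallel edges; a graph is simple if it has no parallel edges. A plane graph is a graph embedded in the plane without crossings; it is considered through its embedding data: the cyclic order of the edges around each vertex (a rotation system with $|V|-|E|+|F|=2$, where $F$ is the set of faces it determines) and the choice of the outer face. The degree of a face is the number of vertices incident with it, and $\Delta^*(G)$ is the maximum face degree of $G$. A graph is $2$-connected if it has at least two vertices, is connected and has no cut vertex; it is $3$-connected if it has at least four vertices and cannot be disconnected by deleting at most two vertices. A cycle may have length $2$ (two parallel edges). A cycle $C$ of a plane graph $G$ is separating if at least one vertex or edge of $G$ lies inside $C$ and at least one vertex or edge of $G$ lies outside $C$. A plane graph $G$ is a subdivision of a plane graph $R$ if it is obtained from $R$ by a (possibly empty) sequence of operations each replacing an edge $uv$ by a path $u,w,v$ through a new vertex $w$. **Theorem.** Let $G$ be a $2$-connected plane graph with at least four faces. Then at least one of the following holds: (i) $G$ is a subdivision of a simple $3$-connected plane graph; (ii) $G$ contains a separating cycle $C_n$ of length $n \le \Delta^*(G)$. -/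

import Mathlib

universe u

/-- A finite multigraph without loops, given by its vertices, its darts (oriented edges), the source
of a dart and the reversal of a dart. An edge is a pair `{d, rev d}`; parallel edges are allowed. -/
structure Multigraph where
  V : Type u
  D : Type u
  [finV : Finite V]
  [finD : Finite D]
  src : D → V
  rev : D → D
  rev_rev : ∀ d, rev (rev d) = d
  rev_ne : ∀ d, rev d ≠ d
  loopless : ∀ d, src (rev d) ≠ src d

namespace Multigraph

attribute [instance] Multigraph.finV Multigraph.finD

/-- The edge underlying a dart. -/
def edge (G : Multigraph.{u}) (d : G.D) : Sym2 G.D := s(d, G.rev d)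

/-- The set of edges. -/
def edgeSet (G : Multigraph.{u}) : Set (Sym2 G.D) := Set.range G.edge

/-- The underlying simple graph: two vertices are adjacent if some edge joins them. -/
def toSimple (G : Multigraph.{u}) : SimpleGraph G.V where
  Adj x y := ∃ d, G.src d = x ∧ G.src (G.rev d) = y
  symm := ⟨by
    rintro x y ⟨d, rfl, rfl⟩
    exact ⟨G.rev d, rfl, by rw [G.rev_rev]⟩⟩
  loopless := ⟨by
    rintro x ⟨d, rfl, h⟩
    exact G.loopless d h⟩

/-- No two edges are parallel. -/
def IsSimple (G : Multigraph.{u}) : Prop :=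
  ∀ d e, G.src d = G.src e → G.src (G.rev d) = G.src (G.rev e) → d = e

/-- At least two vertices, connected, and no cut vertex. (The two-vertex multigraphs formed by
parallel edges are included.) -/
def IsTwoConnected (G : Multigraph.{u}) : Prop :=
  2 ≤ Nat.card G.V ∧ ∀ S : Set G.V, S.ncard < 2 → (G.toSimple.induce Sᶜ).Connected

/-- At least four vertices, and deleting at most two vertices never disconnects the graph. -/
def IsThreeConnected (G : Multigraph.{u}) : Prop :=
  4 ≤ Nat.card G.V ∧ ∀ S : Set G.V, S.ncard < 3 → (G.toSimple.induce Sᶜ).Connected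

/-- A cycle, as a cyclic sequence of darts: each dart ends where the following one starts, no vertex
is repeated and no edge is used twice. Two parallel edges form a cycle of length two. -/
def IsCycle (G : Multigraph.{u}) (C : Cycle G.D) : Prop :=
  C ≠ Cycle.nil ∧ C.Chain (fun d e => G.src (G.rev d) = G.src e) ∧ (C.map G.src).Nodup ∧
    ∀ d ∈ C, G.rev d ∉ C

end Multigraph

/-- A multigraph embedded in an oriented closed surface, given by its rotation system: `next` lists
the darts leaving each vertex in their cyclic order around that vertex. -/
structure EmbeddedGraph extends Multigraph.{u} where
  next : Equiv.Perm D
  sameCycle_next : ∀ d e, next.SameCycle d e ↔ src d = src e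

namespace EmbeddedGraph

/-- Face tracing: the successor of the dart `d` on the boundary of the face at its side. -/
def facePerm (G : EmbeddedGraph.{u}) : Equiv.Perm G.D :=
  (Function.Involutive.toPerm G.rev G.rev_rev).trans G.next

/-- The faces are the orbits of face tracing. -/
def Face (G : EmbeddedGraph.{u}) : Type u := Quotient (Equiv.Perm.SameCycle.setoid G.facePerm)

/-- The face at the side of the dart `d`; the face on the other side of the same edge is
`G.face (G.rev d)`. -/
def face (G : EmbeddedGraph.{u}) (d : G.D) : G.Face := Quotient.mk _ d

/-- The number of vertices incident with a face. -/
noncomputable def faceDegree (G : EmbeddedGraph.{u}) (f : G.Face) : ℕ :=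
  {v | ∃ d, G.src d = v ∧ G.face d = f}.ncard

/-- The maximum face degree. -/
noncomputable def maxFaceDegree (G : EmbeddedGraph.{u}) : ℕ := ⨆ f : G.Face, G.faceDegree f

end EmbeddedGraph

/-- A connected plane graph (with at least one edge): a connected graph embedded in the sphere, that
is, of Euler characteristic `|V| - |E| + |F| = 2`, with one face chosen as the outer (unbounded)
face. -/
structure PlaneGraph extends EmbeddedGraph.{u} where
  connected : toMultigraph.toSimple.Connected
  euler : Nat.card V + Nat.card toEmbeddedGraph.Face = toMultigraph.edgeSet.ncard + 2
  outer : toEmbeddedGraph.Face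

namespace PlaneGraph

/-- Two faces share an edge that does not belong to `C`. -/
def AdjOff (G : PlaneGraph.{u}) (C : Cycle G.D) (f g : G.Face) : Prop :=
  ∃ d, d ∉ C ∧ G.rev d ∉ C ∧ G.face d = f ∧ G.face (G.rev d) = g

/-- The face `f` lies outside `C`: it can be reached from the outer face without crossing `C`. -/
def FaceOutside (G : PlaneGraph.{u}) (C : Cycle G.D) (f : G.Face) : Prop :=
  Relation.ReflTransGen (G.AdjOff C) G.outer f

/-- The vertices and edges that do not lie on `C` and are incident with a face satisfying `P`. -/
def partOff (G : PlaneGraph.{u}) (C : Cycle G.D) (P : G.Face → Prop) : Set (G.V ⊕ Sym2 G.D) :=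
  {x | (∃ d, x = Sum.inl (G.src d) ∧ G.src d ∉ C.map G.src ∧ P (G.face d)) ∨
    (∃ d, x = Sum.inr (G.edge d) ∧ d ∉ C ∧ G.rev d ∉ C ∧ P (G.face d))}

/-- The set of vertices and edges lying outside `C`. -/
def ext (G : PlaneGraph.{u}) (C : Cycle G.D) : Set (G.V ⊕ Sym2 G.D) :=
  G.partOff C (G.FaceOutside C)

/-- The set of vertices and edges lying inside `C`. -/
def int (G : PlaneGraph.{u}) (C : Cycle G.D) : Set (G.V ⊕ Sym2 G.D) :=
  G.partOff C (fun f => ¬ G.FaceOutside C f)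

/-- A separating cycle: something lies inside it and something lies outside it. -/
def IsSeparatingCycle (G : PlaneGraph.{u}) (C : Cycle G.D) : Prop :=
  G.IsCycle C ∧ (G.int C).Nonempty ∧ (G.ext C).Nonempty

/-- `H` arises from `G` by subdividing one edge, namely the edge of the dart `d`: there is one new
vertex `w` and there are two new darts `a`, `b` leaving `w`, where `a` reverses (what is left of) `d`
and `b` reverses (what is left of) `rev d`. The rotations at the old vertices and the outer face are
kept. -/
def IsEdgeSubdivision (G H : PlaneGraph.{u}) : Prop :=
  ∃ (fV : Option G.V ≃ H.V) (fD : G.D ⊕ Bool ≃ H.D) (d : G.D),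
    let w := fV none
    let a := fD (Sum.inr false)
    let b := fD (Sum.inr true)
    (∀ x, H.src (fD (Sum.inl x)) = fV (some (G.src x))) ∧ H.src a = w ∧ H.src b = w ∧
    H.rev (fD (Sum.inl d)) = a ∧ H.rev (fD (Sum.inl (G.rev d))) = b ∧
    (∀ x, x ≠ d → x ≠ G.rev d → H.rev (fD (Sum.inl x)) = fD (Sum.inl (G.rev x))) ∧
    (∀ x, H.next (fD (Sum.inl x)) = fD (Sum.inl (G.next x))) ∧
    (∀ x, H.face (fD (Sum.inl x)) = H.outer ↔ G.face x = G.outer)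

/-- `G` is a subdivision of `R`: it arises from `R` by a (possibly empty) sequence of subdivisions of
edges. -/
def IsSubdivisionOf (G R : PlaneGraph.{u}) : Prop :=
  Relation.ReflTransGen IsEdgeSubdivision R G

end PlaneGraph

/-! The dichotomy is governed by `IsDegenerate`: the edges split into two parts sharing at most two
vertices `x`, `y`, each part having at least as many edges as vertices, so that neither is a path.

If the graph is degenerate, look at the angles at `x` where the rotation changes from one part to
the other. By 2-connectedness a face passes each vertex at most once, so a face entering a part at
`x` leaves it at `y`. Two such faces `f`, `g` are thus each cut into an arc in `S` and an arc in
`Sᶜ`. Joining the `S`-arc of one face to the `Sᶜ`-arc of the other gives two cycles of total length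
at most `deg f + deg g`, so one has length at most the maximum face degree. Both cycles separate `f`
from `g`, and both are separating unless one face borders only the other along a whole part. With
just two changes at `x` this would make the part a path (`IsTwoSep.ncard_lt`). With more changes,
two non-consecutive angles at `x` yield a new 2-separation in which such bordering is impossible
(`hasShortSeparatingCycle_of_common_vertices`).

If the graph is not degenerate, suppress vertices of degree two. Degeneracy passes to subdivisions,
so its absence is inherited by the smaller graphs. With at least four faces a pair of parallel edges
is degenerate by Euler's formula; once all degrees are at least three, so is any separation by at
most two vertices. What remains is simple and 3-connected (`exists_isSubdivisionOf`).

The Jordan curve theorem enters through `exists_facePotential`: Euler's formula forces every cycle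
mod 2 to be a sum of face boundaries. -/

namespace Multigraph

/-! ### Darts, edges, and connectivity in terms of sets of darts -/

/-- A chosen dart of an edge. -/
noncomputable def edgeDart (G : Multigraph.{u}) (e : G.edgeSet) : G.D := e.2.choose

theorem edge_edgeDart (G : Multigraph.{u}) (e : G.edgeSet) : G.edge (G.edgeDart e) = e :=
  e.2.choose_spec

theorem edge_eq_iff (G : Multigraph.{u}) (d e : G.D) :
    G.edge d = G.edge e ↔ d = e ∨ d = G.rev e := by
  unfold edge
  rw [Sym2.eq_iff]
  constructor
  · rintro (h | h)
    · exact Or.inl h.1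
    · exact Or.inr h.1
  · rintro (rfl | rfl)
    · simp
    · simp [G.rev_rev]

/-- Darts are pairs of an edge and a direction. -/
noncomputable def edgeBoolEquiv (G : Multigraph.{u}) : G.edgeSet × Bool ≃ G.D :=
  Equiv.ofBijective
    (fun p => if p.2 then G.rev (G.edgeDart p.1) else G.edgeDart p.1) (by
    constructor
    · rintro ⟨e, b⟩ ⟨e', b'⟩ h
      have hr : ∀ d, G.edge (G.rev d) = G.edge d := fun d =>
        (G.edge_eq_iff _ _).2 (Or.inr rfl)
      have he : e = e' := by
        have := congrArg G.edge h
        apply Subtype.ext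
        cases b <;> cases b' <;> simpa [hr, edge_edgeDart] using this
      subst he
      cases b <;> cases b' <;> simp [G.rev_ne, (G.rev_ne _).symm] at h ⊢
    · intro d
      have := G.edge_edgeDart ⟨G.edge d, d, rfl⟩
      rcases (G.edge_eq_iff _ _).1 this with h | h
      · exact ⟨(⟨G.edge d, d, rfl⟩, false), by simpa using h⟩
      · exact ⟨(⟨G.edge d, d, rfl⟩, true), by simp [h, G.rev_rev]⟩)

theorem edgeBoolEquiv_false (G : Multigraph.{u}) (e : G.edgeSet) :
    G.edgeBoolEquiv (e, false) = G.edgeDart e := rfl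

theorem edgeBoolEquiv_true (G : Multigraph.{u}) (e : G.edgeSet) :
    G.edgeBoolEquiv (e, true) = G.rev (G.edgeDart e) := rfl

theorem card_darts (G : Multigraph.{u}) : Nat.card G.D = 2 * G.edgeSet.ncard := by
  rw [← Nat.card_congr G.edgeBoolEquiv, Nat.card_prod, Nat.card_eq_fintype_card (α := Bool),
    Fintype.card_bool, mul_comm]
  rfl

theorem sum_darts (G : Multigraph.{u}) [Fintype G.D] [Fintype G.edgeSet] {M : Type*}
    [AddCommMonoid M] (F : G.D → M) :
    ∑ d, F d = ∑ e, (F (G.edgeDart e) + F (G.rev (G.edgeDart e))) := by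
  rw [← G.edgeBoolEquiv.sum_comp, Fintype.sum_prod_type]
  refine Finset.sum_congr rfl fun e _ => ?_
  simp [edgeBoolEquiv_false, edgeBoolEquiv_true, add_comm]

theorem rev_injective (G : Multigraph.{u}) : Function.Injective G.rev :=
  fun a b h => by rw [← G.rev_rev a, h, G.rev_rev]

/-- In a connected multigraph, a set of darts closed under reversal and under sharing the source
is trivial. -/
theorem mem_of_connected (G : Multigraph.{u}) (hc : G.toSimple.Connected) {S : Set G.D}
    (hr : ∀ d ∈ S, G.rev d ∈ S) (hs : ∀ x ∈ S, ∀ y, G.src x = G.src y → y ∈ S)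
    {x : G.D} (hx : x ∈ S) (y : G.D) : y ∈ S := by
  have key : ∀ w, G.toSimple.Reachable (G.src x) w → ∀ z, G.src z = w → z ∈ S := by
    intro w hw
    rw [SimpleGraph.reachable_iff_reflTransGen] at hw
    induction hw with
    | refl => exact fun z hz => hs x hx z hz.symm
    | tail _ h ih =>
      obtain ⟨d, rfl, rfl⟩ := h
      exact fun z hz => hs _ (hr _ (ih d rfl)) z hz.symm
  exact key _ (hc.preconnected _ _) y rfl

/-- In a 2-connected multigraph, a set of darts closed under reversal and, except at one vertex,
under sharing the source is trivial. -/
theorem mem_of_isTwoConnected (G : Multigraph.{u}) (hG : G.IsTwoConnected) {S : Set G.D} (v : G.V)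
    (hr : ∀ d, G.rev d ∈ S ↔ d ∈ S)
    (hs : ∀ x ∈ S, ∀ y ∉ S, G.src x = G.src y → G.src x = v)
    {x : G.D} (hx : x ∈ S) (y : G.D) : y ∈ S := by
  have hc := hG.2 {v} (by simp)
  -- There are no loops, so each edge has a dart starting off `v`.
  have hoff : ∀ d, ∃ d', G.src d' ≠ v ∧ (d' ∈ S ↔ d ∈ S) := by
    intro d
    by_cases h : G.src d = v
    · exact ⟨G.rev d, fun h' => G.loopless d (h'.trans h.symm), hr d⟩
    · exact ⟨d, h, Iff.rfl⟩
  obtain ⟨x', hx', hxS⟩ := hoff x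
  obtain ⟨y', hy', hyS⟩ := hoff y
  rw [← hyS]
  have hx'' := hxS.2 hx
  have key : ∀ w, (G.toSimple.induce ({v}ᶜ : Set G.V)).Reachable ⟨G.src x', hx'⟩ w →
      ∀ z, G.src z = w.1 → z ∈ S := by
    intro w hw
    rw [SimpleGraph.reachable_iff_reflTransGen] at hw
    induction hw with
    | refl =>
      intro z hz
      by_contra hzS
      exact hx' (hs _ hx'' z hzS hz.symm)
    | @tail b c _ h ih =>
      obtain ⟨d, hd, hd'⟩ := h
      intro z hz
      by_contra hzS
      have := hs _ ((hr d).2 (ih d hd)) z hzS (hd'.trans hz.symm)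
      exact c.2 (hd'.symm.trans this)
  exact key ⟨G.src y', hy'⟩ (hc.preconnected _ _) y' rfl

end Multigraph

/-! ### Rotation and face tracing -/

namespace EmbeddedGraph

instance (G : EmbeddedGraph.{u}) : Finite G.Face := Quotient.finite _

theorem facePerm_apply (G : EmbeddedGraph.{u}) (d : G.D) : G.facePerm d = G.next (G.rev d) := rfl

theorem src_next (G : EmbeddedGraph.{u}) (d : G.D) : G.src (G.next d) = G.src d :=
  ((G.sameCycle_next _ _).1 (Equiv.Perm.sameCycle_apply_right.2 (Equiv.Perm.SameCycle.refl _ _))).symm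

theorem src_facePerm (G : EmbeddedGraph.{u}) (d : G.D) :
    G.src (G.facePerm d) = G.src (G.rev d) := G.src_next _

theorem face_eq_iff (G : EmbeddedGraph.{u}) (d e : G.D) :
    G.face d = G.face e ↔ G.facePerm.SameCycle d e := Quotient.eq

theorem face_facePerm (G : EmbeddedGraph.{u}) (d : G.D) : G.face (G.facePerm d) = G.face d :=
  (G.face_eq_iff _ _).2 (Equiv.Perm.sameCycle_apply_left.2 (Equiv.Perm.SameCycle.refl _ _))

theorem face_pow (G : EmbeddedGraph.{u}) (d : G.D) (n : ℕ) :
    G.face ((G.facePerm ^ n) d) = G.face d :=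
  (G.face_eq_iff _ _).2 (Equiv.Perm.sameCycle_pow_left.2 (Equiv.Perm.SameCycle.refl _ _))

theorem face_next (G : EmbeddedGraph.{u}) (d : G.D) : G.face (G.next d) = G.face (G.rev d) := by
  rw [← G.face_facePerm (G.rev d), facePerm_apply, G.rev_rev]

theorem face_surjective (G : EmbeddedGraph.{u}) : Function.Surjective G.face := Quotient.mk_surjective

/-- If some but not all darts at a vertex lie in `S`, then rotation leaves `S` somewhere. -/
theorem exists_mem_next_notMem (G : EmbeddedGraph.{u}) {S : Set G.D} {x y : G.D} (hx : x ∈ S)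
    (hy : y ∉ S) (h : G.src x = G.src y) :
    ∃ z ∈ S, G.next z ∉ S ∧ G.src z = G.src x := by
  by_contra! hcon
  obtain ⟨n, hn⟩ := ((G.sameCycle_next _ _).2 h).exists_nat_pow_eq
  have key : ∀ n : ℕ, (G.next ^ n) x ∈ S ∧ G.src ((G.next ^ n) x) = G.src x := by
    intro n
    induction n with
    | zero => exact ⟨hx, rfl⟩
    | succ n ih =>
      rw [pow_succ', Equiv.Perm.mul_apply]
      refine ⟨?_, by rw [src_next, ih.2]⟩
      by_contra h'
      exact hcon _ ih.1 h' ih.2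
  exact hy (hn ▸ (key n).1)

end EmbeddedGraph

/-! ### Cycles mod 2 are sums of face boundaries -/

namespace PlaneGraph

/-- A set of darts of a plane graph closed under reversal and rotation is trivial. -/
theorem mem_of_closed (G : PlaneGraph.{u}) {S : Set G.D} (hr : ∀ d ∈ S, G.rev d ∈ S)
    (hn : ∀ d ∈ S, G.next d ∈ S) {x : G.D} (hx : x ∈ S) (y : G.D) : y ∈ S := by
  refine G.mem_of_connected G.connected hr (fun a ha b hab => ?_) hx y
  by_contra hb
  obtain ⟨z, hz, hz', -⟩ := G.exists_mem_next_notMem ha hb hab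
  exact hz' (hn z hz)

/-- Every `ZMod 2`-cycle of a plane graph is a sum of face boundaries. -/
theorem exists_facePotential (G : PlaneGraph.{u}) [Fintype G.D] [DecidableEq G.V]
    (W : G.D → ZMod 2)
    (hW : ∀ v, ∑ d, (if G.src d = v then W d + W (G.rev d) else 0) = 0) :
    ∃ h : G.Face → ZMod 2, ∀ d, h (G.face d) + h (G.face (G.rev d)) = W d + W (G.rev d) := by
  classical
  have : Fintype G.V := Fintype.ofFinite _
  have : Fintype G.Face := Fintype.ofFinite _
  have : Fintype G.edgeSet := Fintype.ofFinite _
  have : Fact (Nat.Prime 2) := ⟨Nat.prime_two⟩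
  have two : ∀ a b : ZMod 2, a + b = 0 → a = b := fun _ _ => CharTwo.add_eq_zero.1
  obtain ⟨f₀⟩ : Nonempty G.Face := ⟨G.outer⟩
  obtain ⟨d₀, -⟩ := G.face_surjective f₀
  -- `T` is the incidence matrix: it acts as the coboundary and its transpose as the boundary map.
  let T : Matrix G.edgeSet G.V (ZMod 2) := Matrix.of fun e v =>
    (if G.src (G.edgeDart e) = v then 1 else 0) + (if G.src (G.rev (G.edgeDart e)) = v then 1 else 0)
  have hT : ∀ p e, T.mulVec p e = p (G.src (G.edgeDart e)) + p (G.src (G.rev (G.edgeDart e))) := by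
    intro p e
    simp [T, Matrix.mulVec, dotProduct, add_mul, Finset.sum_add_distrib]
  have hTt : ∀ (F : G.D → ZMod 2) (hF : ∀ d, F (G.rev d) = F d) v,
      T.transpose.mulVec (fun e => F (G.edgeDart e)) v =
        ∑ d, (if G.src d = v then F d else 0) := by
    intro F hF v
    rw [G.sum_darts]
    simp only [Matrix.mulVec, dotProduct, Matrix.transpose_apply, Matrix.of_apply, T]
    refine Finset.sum_congr rfl fun e _ => ?_
    rw [hF, add_mul]
    simp
  have hkerT : Module.finrank (ZMod 2) (LinearMap.ker T.mulVecLin) ≤ 1 := by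
    refine finrank_le_one (⟨fun _ => 1, ?_⟩) ?_
    · rw [LinearMap.mem_ker]
      ext e
      simp only [Matrix.mulVecLin_apply, hT, Pi.zero_apply]
      exact CharTwo.add_self_eq_zero _
    · rintro ⟨p, hp⟩
      refine ⟨p (G.src d₀), Subtype.ext ?_⟩
      have hp' : ∀ d, p (G.src d) = p (G.src (G.rev d)) := by
        intro d
        obtain ⟨⟨e, b⟩, rfl⟩ := G.edgeBoolEquiv.surjective d
        have := congrFun (LinearMap.mem_ker.1 hp) e
        rw [Matrix.mulVecLin_apply, hT] at this
        have := two _ _ this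
        cases b <;> simp [Multigraph.edgeBoolEquiv_false, Multigraph.edgeBoolEquiv_true, G.rev_rev, this]
      have hall : ∀ w, G.toSimple.Reachable (G.src d₀) w → p w = p (G.src d₀) := by
        intro w hw
        rw [SimpleGraph.reachable_iff_reflTransGen] at hw
        induction hw with
        | refl => rfl
        | tail _ h ih =>
          obtain ⟨d, rfl, rfl⟩ := h
          rw [← hp', ih]
      ext w
      simp [hall w (G.connected.preconnected _ _)]
  let δ : (G.Face → ZMod 2) →ₗ[ZMod 2] (G.edgeSet → ZMod 2) :=
    { toFun := fun h e => h (G.face (G.edgeDart e)) + h (G.face (G.rev (G.edgeDart e)))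
      map_add' := by intro a b; ext e; simp; ring
      map_smul' := by intro a b; ext e; simp; ring }
  have hδ : ∀ h e, δ h e = h (G.face (G.edgeDart e)) + h (G.face (G.rev (G.edgeDart e))) :=
    fun _ _ => rfl
  have hkerδ : Module.finrank (ZMod 2) (LinearMap.ker δ) ≤ 1 := by
    refine finrank_le_one (⟨fun _ => 1, ?_⟩) ?_
    · rw [LinearMap.mem_ker]
      ext e
      simp only [hδ, Pi.zero_apply]
      exact CharTwo.add_self_eq_zero _
    · rintro ⟨h, hh⟩
      refine ⟨h (G.face d₀), Subtype.ext ?_⟩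
      have hp' : ∀ d, h (G.face (G.rev d)) = h (G.face d) := by
        intro d
        obtain ⟨⟨e, b⟩, rfl⟩ := G.edgeBoolEquiv.surjective d
        have := congrFun (LinearMap.mem_ker.1 hh) e
        rw [hδ] at this
        have := two _ _ this
        cases b <;> simp [Multigraph.edgeBoolEquiv_false, Multigraph.edgeBoolEquiv_true, G.rev_rev, this]
      -- The dual graph is connected: rotation by one dart moves to the face across an edge.
      have hall : ∀ d, d ∈ {d | h (G.face d) = h (G.face d₀)} := by
        refine G.mem_of_closed (x := d₀) (fun d hd => ?_) (fun d hd => ?_) rfl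
        · simpa [hp'] using hd
        · simpa [G.face_next, hp'] using hd
      ext f
      obtain ⟨d, rfl⟩ := G.face_surjective f
      simpa using (hall d).symm
  have hle : LinearMap.range δ ≤ LinearMap.ker T.transpose.mulVecLin := by
    rintro _ ⟨h, rfl⟩
    rw [LinearMap.mem_ker, Matrix.mulVecLin_apply]
    ext v
    have := hTt (fun d => h (G.face d) + h (G.face (G.rev d)))
      (fun d => by rw [G.rev_rev, add_comm]) v
    refine Eq.trans this ?_
    -- Each angle at `v` is counted once by each of its two darts, so face boundaries are cycles.
    have hsplit : ∀ d, (if G.src d = v then h (G.face d) + h (G.face (G.rev d)) else 0) =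
        (if G.src d = v then h (G.face d) else 0) +
        (if G.src (G.next d) = v then h (G.face (G.next d)) else 0) := by
      intro d
      rw [G.src_next, G.face_next]
      split_ifs <;> simp
    simp only [hsplit, Finset.sum_add_distrib]
    rw [Equiv.sum_comp G.next (fun d => if G.src d = v then h (G.face d) else 0)]
    exact CharTwo.add_self_eq_zero _
  have heq : LinearMap.range δ = LinearMap.ker T.transpose.mulVecLin := by
    -- The cycle space has dimension at most `|E| - |V| + 1`, which is `|F| - 1` by Euler's formula,
    -- and `range δ` has at least that dimension.
    apply Submodule.eq_of_le_of_finrank_le hle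
    have h1 := δ.finrank_range_add_finrank_ker
    have h2 := T.mulVecLin.finrank_range_add_finrank_ker
    have h3 := T.transpose.mulVecLin.finrank_range_add_finrank_ker
    have h4 : Module.finrank (ZMod 2) (LinearMap.range T.transpose.mulVecLin) =
      Module.finrank (ZMod 2) (LinearMap.range T.mulVecLin) := T.rank_transpose
    rw [Module.finrank_fintype_fun_eq_card] at h1 h2 h3
    have h5 := G.euler
    rw [Nat.card_eq_fintype_card, Nat.card_eq_fintype_card] at h5
    have h6 : G.edgeSet.ncard = Fintype.card G.edgeSet := by
      rw [← Nat.card_coe_set_eq, Nat.card_eq_fintype_card]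
    omega
  have hmem : (fun e => W (G.edgeDart e) + W (G.rev (G.edgeDart e))) ∈ LinearMap.range δ := by
    rw [heq, LinearMap.mem_ker, Matrix.mulVecLin_apply]
    ext v
    exact (hTt (fun d => W d + W (G.rev d)) (fun d => by rw [G.rev_rev, add_comm]) v).trans (hW v)
  obtain ⟨h, hh⟩ := hmem
  refine ⟨h, fun d => ?_⟩
  obtain ⟨⟨e, b⟩, rfl⟩ := G.edgeBoolEquiv.surjective d
  have := congrFun hh e
  rw [hδ] at this
  cases b
  · simpa [Multigraph.edgeBoolEquiv_false] using this
  · simpa [Multigraph.edgeBoolEquiv_false, Multigraph.edgeBoolEquiv_true, G.rev_rev, add_comm] using this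

end PlaneGraph

/-! ### Facial walks as chains mod 2 -/

namespace EmbeddedGraph

open Classical in
/-- The `ZMod 2`-indicator of the first `m` darts of face tracing from `a`, with multiplicity. -/
noncomputable def arcInd (G : EmbeddedGraph.{u}) (a : G.D) (m : ℕ) (x : G.D) : ZMod 2 :=
  ∑ i ∈ Finset.range m, if (G.facePerm ^ i) a = x then 1 else 0

-- Contributions of consecutive darts cancel; only the start of the walk and the dart following its
-- end survive.
open Classical in
theorem arcInd_add_arcInd_facePerm (G : EmbeddedGraph.{u}) (a : G.D) (m : ℕ) (x : G.D) :
    G.arcInd a m x + G.arcInd a m (G.facePerm x) =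
      (if a = G.facePerm x then 1 else 0) + if (G.facePerm ^ m) a = G.facePerm x then 1 else 0 := by
  induction m with
  | zero => simp [arcInd, CharTwo.add_self_eq_zero]
  | succ m ih =>
    have h : (G.facePerm ^ (m + 1)) a = G.facePerm x ↔ (G.facePerm ^ m) a = x := by
      rw [pow_succ', Equiv.Perm.mul_apply, EmbeddingLike.apply_eq_iff_eq]
    simp only [arcInd, Finset.sum_range_succ] at ih ⊢
    rw [add_add_add_comm, ih]
    simp only [h]
    rw [add_comm (if (G.facePerm ^ m) a = x then (1 : ZMod 2) else 0), add_assoc, ← add_assoc _ _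
      (if (G.facePerm ^ m) a = x then (1 : ZMod 2) else 0), CharTwo.add_self_eq_zero, zero_add]

/-- The boundary of a walk mod 2 consists of its two ends. -/
theorem sum_arcInd (G : EmbeddedGraph.{u}) [Fintype G.D] [DecidableEq G.V] (a : G.D) (m : ℕ)
    (v : G.V) :
    ∑ d, (if G.src d = v then G.arcInd a m d + G.arcInd a m (G.rev d) else 0) =
      (if G.src a = v then 1 else 0) + if G.src ((G.facePerm ^ m) a) = v then 1 else 0 := by
  classical
  induction m with
  | zero => simp [arcInd, CharTwo.add_self_eq_zero]
  | succ m ih =>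
    set y := (G.facePerm ^ m) a with hy
    have hstep : ∀ d, (if G.src d = v then G.arcInd a (m + 1) d + G.arcInd a (m + 1) (G.rev d)
        else 0) = (if G.src d = v then G.arcInd a m d + G.arcInd a m (G.rev d) else 0) +
        ((if y = d then (if G.src d = v then 1 else 0) else 0) +
          (if G.rev y = d then (if G.src d = v then 1 else 0) else 0)) := by
      intro d
      have h : y = G.rev d ↔ G.rev y = d :=
        ⟨fun h => by rw [h, G.rev_rev], fun h => by rw [← h, G.rev_rev]⟩
      by_cases hd : G.src d = v
      · simp only [hd, if_true, arcInd, Finset.sum_range_succ, ← hy, h]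
        ring
      · simp [hd]
    simp only [hstep, Finset.sum_add_distrib, ih, Finset.sum_ite_eq, Finset.mem_univ, if_true]
    have h1 : (G.facePerm ^ (m + 1)) a = G.facePerm y := by
      rw [pow_succ', Equiv.Perm.mul_apply]
    rw [h1, G.src_facePerm]
    rw [add_assoc, ← add_assoc _ _ (if G.src (G.rev y) = v then (1 : ZMod 2) else 0),
      CharTwo.add_self_eq_zero, zero_add]

end EmbeddedGraph

/-! ### Edge potentials; faces pass a vertex once -/

namespace PlaneGraph

/-- A function on the darts that is invariant under reversal and, along face tracing, jumps as
prescribed by the `ZMod 2`-cycle `W`. -/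
theorem exists_dartPotential (G : PlaneGraph.{u}) [Fintype G.D] [DecidableEq G.V]
    (W : G.D → ZMod 2)
    (hW : ∀ v, ∑ d, (if G.src d = v then W d + W (G.rev d) else 0) = 0) :
    ∃ H : G.D → ZMod 2, (∀ d, H (G.rev d) = H d) ∧
      ∀ d, H (G.facePerm d) = H d + (W d + W (G.facePerm d)) := by
  obtain ⟨h, hh⟩ := G.exists_facePotential W hW
  -- Adding `W d` corresponds to pushing the walk off its edges into the faces it follows. Each edge
  -- is then on a definite side, and sides change only at angles.
  refine ⟨fun d => h (G.face d) + W d, fun d => ?_, fun d => ?_⟩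
  · have := hh d
    have e : h (G.face (G.rev d)) + W (G.rev d) + (h (G.face d) + W d) = 0 := by
      calc _ = (h (G.face d) + h (G.face (G.rev d))) + (W d + W (G.rev d)) := by ring
        _ = 0 := by rw [this, CharTwo.add_self_eq_zero]
    exact CharTwo.add_eq_zero.1 e
  · simp only [G.face_facePerm]
    have : W d + W d = 0 := CharTwo.add_self_eq_zero _
    linear_combination -this

/-- In a 2-connected plane graph, no face passes twice through a vertex. -/
theorem eq_of_face_eq_of_src_eq (G : PlaneGraph.{u}) (hG : G.IsTwoConnected) {d e : G.D}
    (hf : G.face d = G.face e) (hs : G.src d = G.src e) : d = e := by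
  classical
  have : Fintype G.D := Fintype.ofFinite _
  by_contra hne
  obtain ⟨m, hm⟩ := ((G.face_eq_iff _ _).1 hf).exists_nat_pow_eq
  -- The part of the face between its two visits is a closed walk. Pushed into the face, it meets
  -- the graph only at the visited vertex, which would be a cut vertex.
  obtain ⟨H, hr, hφ⟩ := G.exists_dartPotential (G.arcInd d m) (fun v => by
    rw [G.sum_arcInd, hm, hs, CharTwo.add_self_eq_zero])
  simp only [G.arcInd_add_arcInd_facePerm, hm] at hφ
  have hnext : ∀ x, d ≠ G.next x → e ≠ G.next x → H (G.next x) = H x := by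
    intro x h1 h2
    have := hφ (G.rev x)
    rw [G.facePerm_apply, G.rev_rev, if_neg h1, if_neg h2, hr] at this
    simpa using this
  have hall := G.mem_of_isTwoConnected hG (S := {x | H x = H d}) (G.src d)
    (fun x => by simp [hr]) (fun x hx y hy hxy => by
      obtain ⟨z, hz, hz', hzx⟩ := G.exists_mem_next_notMem hx hy hxy
      by_contra hne'
      refine hz' ((hnext z ?_ ?_).trans hz)
      · rintro rfl
        exact hne' (by rw [← hzx, G.src_next])
      · rintro rfl
        exact hne' (by rw [← hzx, hs, G.src_next])) (x := d) rfl
  have h1 := hφ (G.facePerm.symm d)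
  rw [Equiv.apply_symm_apply, if_pos rfl, if_neg (Ne.symm hne)] at h1
  have h2 : H (G.facePerm.symm d) = H d := hall _
  rw [h2] at h1
  simp at h1

/-- In a 2-connected plane graph with at least three faces, every vertex has degree at least two. -/
theorem next_ne_of_isTwoConnected (G : PlaneGraph.{u}) (hG : G.IsTwoConnected)
    (hF : 3 ≤ Nat.card G.Face) (d : G.D) : G.next d ≠ d := by
  intro hd
  have honly : ∀ y, G.src d = G.src y → y = d := by
    intro y hy
    by_contra hne
    obtain ⟨z, rfl, hz', -⟩ := G.exists_mem_next_notMem (S := {d}) rfl hne hy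
    exact hz' hd
  -- An edge with an end of degree one is attached only at its other end, hence is the whole graph,
  -- leaving at most two faces.
  have hall := G.mem_of_isTwoConnected hG (S := {d, G.rev d}) (G.src (G.rev d))
    (fun x => by
      simp only [Set.mem_insert_iff, Set.mem_singleton_iff]
      constructor
      · rintro (h | h)
        · exact Or.inr (by rw [← h, G.rev_rev])
        · exact Or.inl (G.rev_injective h)
      · rintro (rfl | rfl)
        · exact Or.inr rfl
        · exact Or.inl (G.rev_rev _))
    (fun x hx y hy hxy => by
      rcases hx with rfl | rfl
      · exact absurd (Or.inl (honly y hxy)) hy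
      · rfl) (x := d) (Or.inl rfl)
  have h1 : Nat.card G.Face ≤ Nat.card G.D := Nat.card_le_card_of_surjective _ G.face_surjective
  have h2 : Nat.card G.D ≤ 2 := by
    rw [← Set.ncard_univ, show (Set.univ : Set G.D) = {d, G.rev d} from
      (Set.eq_univ_of_forall hall).symm]
    exact Set.ncard_insert_le _ _ |>.trans (by simp)
  omega

end PlaneGraph

/-! ### Cycles from indexed sequences of darts -/

namespace Multigraph

theorem isCycle_map_range (G : Multigraph.{u}) {N : ℕ} (hN : 0 < N) {c : ℕ → G.D}
    (hclose : c N = c 0) (hstep : ∀ i < N, G.src (G.rev (c i)) = G.src (c (i + 1)))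
    (hinj : ∀ i < N, ∀ j < N, G.src (c i) = G.src (c j) → i = j)
    (hrev : ∀ i < N, ∀ j < N, G.rev (c i) ≠ c j) :
    G.IsCycle (((List.range N).map c : List G.D) : Cycle G.D) := by
  refine ⟨?_, ?_, ?_, ?_⟩
  · rw [Ne, Cycle.coe_eq_nil]
    simp
    omega
  · obtain ⟨k, rfl⟩ : ∃ k, N = k + 1 := ⟨N - 1, by omega⟩
    have h1 : (List.range (k + 1)).map c = c 0 :: (List.range k).map (c ∘ Nat.succ) := by
      rw [List.range_succ_eq_map]; simp
    have h2 : c 0 :: ((List.range k).map (c ∘ Nat.succ) ++ [c 0]) =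
        (List.range (k + 1 + 1)).map c := by
      rw [List.range_succ, List.map_append, h1]
      simp [hclose]
    rw [h1, Cycle.chain_coe_cons, h2, List.isChain_map, List.isChain_range_succ]
    exact hstep
  · rw [Cycle.map_coe, Cycle.nodup_coe_iff, List.map_map]
    refine List.Nodup.map_on ?_ List.nodup_range
    intro i hi j hj h
    exact hinj i (List.mem_range.1 hi) j (List.mem_range.1 hj) h
  · intro d hd hd'
    rw [Cycle.mem_coe_iff, List.mem_map] at hd hd'
    obtain ⟨i, hi, rfl⟩ := hd
    obtain ⟨j, hj, h⟩ := hd'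
    exact hrev i (List.mem_range.1 hi) j (List.mem_range.1 hj) h.symm

end Multigraph

/-! ### 2-separations, facial arcs, sides of a cycle -/

namespace PlaneGraph

variable {G : PlaneGraph.{u}}

/-- The edges of `S` and the other edges share no vertices except possibly `x` and `y`. -/
structure IsTwoSep (G : PlaneGraph.{u}) (S : Set G.D) (x y : G.V) : Prop where
  rev_mem : ∀ d, G.rev d ∈ S ↔ d ∈ S
  boundary : ∀ d ∈ S, ∀ e ∉ S, G.src d = G.src e → G.src d = x ∨ G.src d = y

theorem IsTwoSep.compl {S : Set G.D} {x y : G.V} (h : G.IsTwoSep S x y) : G.IsTwoSep Sᶜ x y where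
  rev_mem d := not_congr (h.rev_mem d)
  boundary d hd e he hde := by
    rw [hde]
    exact h.boundary e (not_not.1 he) d hd hde.symm

theorem IsTwoSep.symm {S : Set G.D} {x y : G.V} (h : G.IsTwoSep S x y) : G.IsTwoSep S y x where
  rev_mem := h.rev_mem
  boundary d hd e he hde := (h.boundary d hd e he hde).symm

/-- Face tracing enters `S` with the dart `a`. -/
def Enters (G : PlaneGraph.{u}) (S : Set G.D) (a : G.D) : Prop := a ∈ S ∧ G.facePerm.symm a ∉ S

theorem facePerm_symm_apply (G : PlaneGraph.{u}) (a : G.D) :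
    G.facePerm.symm a = G.rev (G.next.symm a) := rfl

/-- The first `m` darts of face tracing from `a` form a path in `S` from `x` to `y`. -/
structure IsArc (G : PlaneGraph.{u}) (S : Set G.D) (x y : G.V) (a : G.D) (m : ℕ) : Prop where
  src_start : G.src a = x
  pos : 0 < m
  src_end : G.src ((G.facePerm ^ m) a) = y
  mem : ∀ i < m, (G.facePerm ^ i) a ∈ S
  inner : ∀ i, 0 < i → i < m →
    G.src ((G.facePerm ^ i) a) ≠ x ∧ G.src ((G.facePerm ^ i) a) ≠ y

theorem facePerm_pow_succ (G : PlaneGraph.{u}) (a : G.D) (i : ℕ) :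
    (G.facePerm ^ (i + 1)) a = G.next (G.rev ((G.facePerm ^ i) a)) := by
  rw [pow_succ', Equiv.Perm.mul_apply, G.facePerm_apply]

theorem src_facePerm_pow_succ (G : PlaneGraph.{u}) (a : G.D) (i : ℕ) :
    G.src ((G.facePerm ^ (i + 1)) a) = G.src (G.rev ((G.facePerm ^ i) a)) := by
  rw [facePerm_pow_succ, G.src_next]

/-- A face of a 2-connected plane graph entering `S` at one of the two attachment vertices leaves `S`
at the other one. -/
theorem IsTwoSep.exists_isArc (hG : G.IsTwoConnected) {S : Set G.D} {x y : G.V}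
    (h : G.IsTwoSep S x y) {a : G.D} (ha : G.Enters S a) (hx : G.src a = x) :
    ∃ m, G.IsArc S x y a m ∧ G.Enters Sᶜ ((G.facePerm ^ m) a) := by
  classical
  have hex : ∃ m, (G.facePerm ^ m) a ∉ S := by
    have : G.facePerm.SameCycle a (G.facePerm.symm a) :=
      ⟨-1, by rw [zpow_neg_one]; rfl⟩
    obtain ⟨n, hn⟩ := this.exists_nat_pow_eq
    exact ⟨n, by rw [hn]; exact ha.2⟩
  set m := Nat.find hex with hm
  have hmS : (G.facePerm ^ m) a ∉ S := Nat.find_spec hex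
  have hlt : ∀ i < m, (G.facePerm ^ i) a ∈ S := fun i hi => not_not.1 (Nat.find_min hex hi)
  have hpos : 0 < m := by
    rcases Nat.eq_zero_or_pos m with h0 | h0
    · rw [h0] at hmS
      exact absurd ha.1 hmS
    · exact h0
  obtain ⟨k, hk⟩ : ∃ k, m = k + 1 := ⟨m - 1, by omega⟩
  have hkS := hlt k (by omega)
  have hne : ∀ i, i < m → ∀ j, G.src ((G.facePerm ^ i) a) = G.src ((G.facePerm ^ j) a) →
      (G.facePerm ^ i) a = (G.facePerm ^ j) a := fun i _ j hij =>
    G.eq_of_face_eq_of_src_eq hG (by rw [G.face_pow, G.face_pow]) hij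
  have hend : G.src ((G.facePerm ^ m) a) = y := by
    have h1 := h.boundary _ ((h.rev_mem _).2 hkS) _ hmS
      (by rw [hk, src_facePerm_pow_succ])
    rw [← src_facePerm_pow_succ, ← hk] at h1
    -- The only dart of this face at `x` is `a`, which lies in `S`; so the face does not leave `S`
    -- at `x`.
    refine h1.resolve_left fun h2 => hmS ?_
    rw [← hne 0 hpos m (by simp [h2, hx])]
    exact ha.1
  refine ⟨m, ⟨hx, hpos, hend, hlt, fun i hi him => ⟨fun h1 => hmS ?_, fun h1 => hmS ?_⟩⟩, hmS, ?_⟩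
  · have h2 := hne i him 0 (by simp [h1, hx])
    have h3 : (G.facePerm ^ m) a = (G.facePerm ^ (m - i)) a := by
      conv_lhs => rw [show m = (m - i) + i by omega, pow_add, Equiv.Perm.mul_apply, h2]
      rfl
    rw [h3]
    exact hlt _ (by omega)
  · rw [← hne i him m (h1.trans hend.symm)]
    exact hlt i him
  · rw [hk, pow_succ', Equiv.Perm.mul_apply, Equiv.symm_apply_apply]
    exact fun h' => h' hkS

theorem IsArc.injective {S : Set G.D} {x y : G.V} {a : G.D} {m : ℕ} (h : G.IsArc S x y a m)
    {i j : ℕ} (hi : i < m) (hj : j < m) (hij : (G.facePerm ^ i) a = (G.facePerm ^ j) a) :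
    i = j := by
  have key : ∀ i j, i < j → j < m → (G.facePerm ^ i) a ≠ (G.facePerm ^ j) a := by
    intro i j hij hj he
    have : (G.facePerm ^ (j - i)) a = a := by
      apply (G.facePerm ^ i).injective
      rw [← Equiv.Perm.mul_apply, ← pow_add, show i + (j - i) = j by omega, he]
    exact (h.inner (j - i) (by omega) (by omega)).1 (by rw [this, h.src_start])
  rcases lt_trichotomy i j with h1 | h1 | h1
  · exact absurd hij (key i j h1 hj)
  · exact h1
  · exact absurd hij.symm (key j i h1 hi)

/-- An arc through all of `S` on a face is not longer than the number of darts of the face in `S`. -/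
theorem IsArc.length_le {S : Set G.D} {x y : G.V} {a : G.D} {m : ℕ} (h : G.IsArc S x y a m) :
    m ≤ {d | G.face d = G.face a ∧ d ∈ S}.ncard := by
  have h1 : ((fun i => (G.facePerm ^ i) a) '' (Set.Iio m)).ncard = m := by
    rw [Set.InjOn.ncard_image]
    · rw [← Nat.card_coe_set_eq]; simp
    · exact fun i hi j hj hij => h.injective hi hj hij
  conv_lhs => rw [← h1]
  apply Set.ncard_le_ncard _ (Set.toFinite _)
  rintro _ ⟨i, hi, rfl⟩
  exact ⟨G.face_pow a i, h.mem i hi⟩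

/-- A face visits each vertex at most once; this lets arc lengths be compared with face degrees. -/
theorem faceDegree_eq_ncard (hG : G.IsTwoConnected) (f : G.Face) :
    G.faceDegree f = {d | G.face d = f}.ncard := by
  have : {v | ∃ d, G.src d = v ∧ G.face d = f} = G.src '' {d | G.face d = f} := by
    ext v
    constructor
    · rintro ⟨d, h1, h2⟩
      exact ⟨d, h2, h1⟩
    · rintro ⟨d, h1, h2⟩
      exact ⟨d, h2, h1⟩
  rw [EmbeddedGraph.faceDegree, this, Set.InjOn.ncard_image]
  intro d hd e he hde
  exact G.eq_of_face_eq_of_src_eq hG (Eq.trans hd (Eq.symm he)) hde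

theorem faceDegree_le_maxFaceDegree (f : G.Face) : G.faceDegree f ≤ G.maxFaceDegree :=
  le_ciSup (Set.finite_range _).bddAbove f

/-- A face on both sides of an edge would leave the end of `d` both by `rev d` and by `next (rev
d)`. -/
theorem face_rev_ne (hG : G.IsTwoConnected) (hn : ∀ d, G.next d ≠ d) (d : G.D) :
    G.face (G.rev d) ≠ G.face d := by
  intro h
  have : G.facePerm d = G.rev d :=
    G.eq_of_face_eq_of_src_eq hG (by rw [G.face_facePerm, h]) (G.src_facePerm d)
  exact hn _ this

theorem adjOff_symm {C : Cycle G.D} {f g : G.Face} (h : G.AdjOff C f g) : G.AdjOff C g f := by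
  obtain ⟨d, h1, h2, h3, h4⟩ := h
  exact ⟨G.rev d, h2, by rwa [G.rev_rev], h4, by rwa [G.rev_rev]⟩

/-- `f` and `g` are on the same side of `C`. -/
abbrev SameSide (G : PlaneGraph.{u}) (C : Cycle G.D) : G.Face → G.Face → Prop :=
  Relation.ReflTransGen (G.AdjOff C)

theorem SameSide.symm {C : Cycle G.D} {f g : G.Face} (h : G.SameSide C f g) :
    G.SameSide C g f := by
  induction h with
  | refl => exact .refl
  | tail _ h ih => exact .head (adjOff_symm h) ih

/-- Rotating from one dart of `C` to the next one at a vertex does not change the side. -/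
theorem sameSide_rotate {C : Cycle G.D} {a b : G.D} (hab : G.src a = G.src b) (hne : a ≠ b)
    (hoff : ∀ d, G.src d = G.src a → d ≠ a → d ≠ b → d ∉ C ∧ G.rev d ∉ C) :
    G.SameSide C (G.face (G.rev a)) (G.face b) := by
  classical
  have hex : ∃ n, (G.next ^ (n + 1)) a = b := by
    obtain ⟨n, hn⟩ := ((G.sameCycle_next _ _).2 hab).exists_nat_pow_eq
    cases n with
    | zero => exact absurd hn hne
    | succ n => exact ⟨n, hn⟩
  have hsrc : ∀ n : ℕ, G.src ((G.next ^ n) a) = G.src a := by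
    intro n
    induction n with
    | zero => rfl
    | succ n ih => rw [pow_succ', Equiv.Perm.mul_apply, G.src_next, ih]
  set n := Nat.find hex with hn
  have hspec : (G.next ^ (n + 1)) a = b := Nat.find_spec hex
  have hnb : ∀ i < n, (G.next ^ (i + 1)) a ≠ b := fun i hi => Nat.find_min hex hi
  have hna : ∀ i < n, (G.next ^ (i + 1)) a ≠ a := by
    intro i hi h
    have : (G.next ^ (n - 1 - i + 1)) a = b := by
      have h' : (G.next ^ (n + 1)) a = (G.next ^ (n - 1 - i + 1)) ((G.next ^ (i + 1)) a) := by
        rw [← Equiv.Perm.mul_apply, ← pow_add, show n - 1 - i + 1 + (i + 1) = n + 1 by omega]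
      rw [← hspec, h', h]
    exact hnb _ (by omega) this
  have key : ∀ i ≤ n, G.SameSide C (G.face (G.rev a)) (G.face ((G.next ^ (i + 1)) a)) := by
    intro i
    induction i with
    | zero =>
      intro _
      rw [zero_add, pow_one, G.face_next]
    | succ i ih =>
      intro hi
      refine (ih (by omega)).tail ?_
      obtain ⟨h1, h2⟩ := hoff _ (hsrc (i + 1)) (hna i (by omega)) (hnb i (by omega))
      refine ⟨_, h1, h2, rfl, ?_⟩
      rw [pow_succ' _ (i + 1), Equiv.Perm.mul_apply, G.face_next]
  rw [← hspec]
  exact key n le_rfl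

end PlaneGraph

/-! ### The cycle formed by two arcs and its two sides -/

namespace PlaneGraph

variable {G : PlaneGraph.{u}}

/-- The cycle running along the arc from `a` and back along the arc from `b`. -/
def arcCycle (G : PlaneGraph.{u}) (a b : G.D) (m n : ℕ) : Cycle G.D :=
  (((List.range (m + n)).map fun i => if i < m then (G.facePerm ^ i) a else
    -- The value `a` is taken only from index `m + n` on, outside the list; it makes the sequence
    -- close up in `isCycle_map_range`.
    if i < m + n then G.rev ((G.facePerm ^ (m + n - 1 - i)) b) else a : List G.D) : Cycle G.D)

theorem length_arcCycle (G : PlaneGraph.{u}) (a b : G.D) (m n : ℕ) :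
    (G.arcCycle a b m n).length = m + n := by
  simp [arcCycle]

theorem mem_arcCycle (G : PlaneGraph.{u}) (a b : G.D) (m n : ℕ) (d : G.D) :
    d ∈ G.arcCycle a b m n ↔
      (∃ i < m, (G.facePerm ^ i) a = d) ∨ ∃ j < n, (G.facePerm ^ j) b = G.rev d := by
  rw [arcCycle, Cycle.mem_coe_iff, List.mem_map]
  simp only [List.mem_range]
  constructor
  · rintro ⟨i, hi, h⟩
    by_cases him : i < m
    · exact Or.inl ⟨i, him, by simpa [him] using h⟩
    · rw [if_neg him, if_pos hi] at h
      exact Or.inr ⟨m + n - 1 - i, by omega, by rw [← h, G.rev_rev]⟩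
  · rintro (⟨i, hi, h⟩ | ⟨j, hj, h⟩)
    · exact ⟨i, by omega, by simpa [hi] using h⟩
    · refine ⟨m + n - 1 - j, by omega, ?_⟩
      rw [if_neg (by omega), if_pos (by omega), show m + n - 1 - (m + n - 1 - j) = j by omega, h,
        G.rev_rev]

section

variable {S : Set G.D} {x y : G.V} {a b : G.D} {m n : ℕ}

theorem IsArc.src_injective (hG : G.IsTwoConnected) (ha : G.IsArc S x y a m)
    (hxy : x ≠ y) {i j : ℕ} (hi : i ≤ m) (hj : j ≤ m)
    (h : G.src ((G.facePerm ^ i) a) = G.src ((G.facePerm ^ j) a)) : i = j := by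
  have h0 : ∀ i < m, G.src ((G.facePerm ^ i) a) ≠ y := by
    intro i hi
    rcases Nat.eq_zero_or_pos i with rfl | hp
    · simpa [ha.src_start] using hxy
    · exact (ha.inner i hp hi).2
  rcases hi.lt_or_eq with hi | rfl <;> rcases hj.lt_or_eq with hj | rfl
  · exact ha.injective hi hj
      (G.eq_of_face_eq_of_src_eq hG (by rw [G.face_pow, G.face_pow]) h)
  · exact absurd (h.trans ha.src_end) (h0 i hi)
  · exact absurd (h.symm.trans ha.src_end) (h0 j hj)
  · rfl

/-- Arcs on different sides of a 2-separation share only their ends. -/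
theorem IsTwoSep.arc_disjoint (h : G.IsTwoSep S x y) (ha : G.IsArc S x y a m)
    (hb : G.IsArc Sᶜ x y b n) {i j : ℕ} (hi0 : 0 < i) (hi : i < m) (hj : j ≤ n) :
    G.src ((G.facePerm ^ i) a) ≠ G.src ((G.facePerm ^ j) b) := by
  intro heq
  have hex : ∃ e ∉ S, G.src e = G.src ((G.facePerm ^ j) b) := by
    rcases Nat.eq_zero_or_pos j with rfl | hp
    · exact ⟨b, hb.mem 0 hb.pos, rfl⟩
    · obtain ⟨k, rfl⟩ : ∃ k, j = k + 1 := ⟨j - 1, by omega⟩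
      exact ⟨_, fun h' => hb.mem k (by omega) ((h.rev_mem _).1 h'),
        (src_facePerm_pow_succ G b k).symm⟩
  obtain ⟨e, he, hes⟩ := hex
  rcases h.boundary _ (ha.mem i hi) e he (heq.trans hes.symm) with h1 | h1
  · exact (ha.inner i hi0 hi).1 h1
  · exact (ha.inner i hi0 hi).2 h1

/-- The arcs share only their ends. No edge is used twice: within an arc all darts belong to one
face, and the two arcs lie in `S` and `Sᶜ`. -/
theorem isCycle_arcCycle (hG : G.IsTwoConnected) (hn : ∀ d, G.next d ≠ d) (hxy : x ≠ y)
    (h : G.IsTwoSep S x y) (ha : G.IsArc S x y a m) (hb : G.IsArc Sᶜ x y b n) :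
    G.IsCycle (G.arcCycle a b m n) := by
  have hmp := ha.pos
  have hnp := hb.pos
  have hsb : ∀ i, m ≤ i → i < m + n → G.src (G.rev ((G.facePerm ^ (m + n - 1 - i)) b)) =
      G.src ((G.facePerm ^ (m + n - i)) b) := by
    intro i h1 h2
    rw [show m + n - i = (m + n - 1 - i) + 1 by omega, src_facePerm_pow_succ]
  have hcross : ∀ i < m, ∀ j, m ≤ j → j < m + n →
      G.src ((G.facePerm ^ i) a) ≠ G.src ((G.facePerm ^ (m + n - j)) b) := by
    intro i hi j hj hj' heq
    rcases Nat.eq_zero_or_pos i with rfl | hp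
    · rw [show G.src ((G.facePerm ^ 0) a) = G.src ((G.facePerm ^ 0) b) from
        ha.src_start.trans hb.src_start.symm] at heq
      have := hb.src_injective hG hxy (Nat.zero_le _) (by omega) heq
      omega
    · exact h.arc_disjoint ha hb hp hi (by omega) heq
  refine G.isCycle_map_range (by omega) ?_ ?_ ?_ ?_
  · simp [hmp]
  · intro i hi
    by_cases h1 : i + 1 < m
    · rw [if_pos (by omega), if_pos h1, src_facePerm_pow_succ]
    · by_cases h2 : i < m
      · obtain rfl : m = i + 1 := by omega
        rw [if_pos h2, if_neg h1, if_pos (by omega), hsb _ le_rfl (by omega),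
          ← src_facePerm_pow_succ, ha.src_end, show i + 1 + n - (i + 1) = n by omega, hb.src_end]
      · rw [if_neg h2, if_neg h1, if_pos hi, G.rev_rev]
        by_cases h3 : i + 1 < m + n
        · rw [if_pos h3, hsb _ (by omega) h3]
          congr 3
          omega
        · rw [if_neg h3, show m + n - 1 - i = 0 by omega, ha.src_start]
          exact hb.src_start
  · intro i hi j hj hij
    by_cases h1 : i < m <;> by_cases h2 : j < m
    · rw [if_pos h1, if_pos h2] at hij
      exact ha.src_injective hG hxy h1.le h2.le hij
    · rw [if_pos h1, if_neg h2, if_pos hj, hsb _ (by omega) hj] at hij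
      exact absurd hij (hcross i h1 j (by omega) hj)
    · rw [if_neg h1, if_pos hi, if_pos h2, hsb _ (by omega) hi] at hij
      exact absurd hij.symm (hcross j h2 i (by omega) hi)
    · rw [if_neg h1, if_pos hi, if_neg h2, if_pos hj, hsb _ (by omega) hi,
        hsb _ (by omega) hj] at hij
      have := hb.src_injective hG hxy (by omega) (by omega) hij
      omega
  · intro i hi j hj hij
    by_cases h1 : i < m <;> by_cases h2 : j < m
    · rw [if_pos h1, if_pos h2] at hij
      apply face_rev_ne hG hn ((G.facePerm ^ i) a)
      rw [hij, G.face_pow, G.face_pow]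
    · rw [if_pos h1, if_neg h2, if_pos hj] at hij
      refine hb.mem (m + n - 1 - j) (by omega) ?_
      rw [← G.rev_injective hij]
      exact ha.mem i h1
    · rw [if_neg h1, if_pos hi, if_pos h2, G.rev_rev] at hij
      refine hb.mem (m + n - 1 - i) (by omega) ?_
      rw [hij]
      exact ha.mem j h2
    · rw [if_neg h1, if_pos hi, if_neg h2, if_pos hj, G.rev_rev] at hij
      apply face_rev_ne hG hn ((G.facePerm ^ (m + n - 1 - j)) b)
      rw [← hij, G.face_pow, G.face_pow]

/-- The faces across the arc from `a` are on the same side as the face of `b`. -/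
theorem sameSide_rev_arc (hG : G.IsTwoConnected) (hxy : x ≠ y)
    (h : G.IsTwoSep S x y) (ha : G.IsArc S x y a m) (hb : G.IsArc Sᶜ x y b n) {C : Cycle G.D}
    (hC : ∀ d, d ∈ C ∨ G.rev d ∈ C → (∃ i < m, (G.facePerm ^ i) a = d ∨ (G.facePerm ^ i) a = G.rev d) ∨
      ∃ j < n, (G.facePerm ^ j) b = d ∨ (G.facePerm ^ j) b = G.rev d) {i : ℕ} (hi : i < m) :
    G.SameSide C (G.face (G.rev ((G.facePerm ^ i) a))) (G.face b) := by
  have hab : a ≠ b := fun hab => hb.mem 0 hb.pos (by simpa [← hab] using ha.mem 0 ha.pos)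
  have hsrcrev : ∀ (c d : G.D) (k : ℕ), (G.facePerm ^ k) c = G.rev d →
      G.src d = G.src ((G.facePerm ^ (k + 1)) c) := by
    intro c d k hk
    rw [src_facePerm_pow_succ, hk, G.rev_rev]
  induction i with
  | zero =>
    -- At `x` only `a` and `b` belong to edges of the cycle, so rotation from `a` to `b` stays on
    -- one side.
    refine sameSide_rotate (ha.src_start.trans hb.src_start.symm) hab fun d hd hda hdb => ?_
    by_contra hcon
    rw [← not_or, not_not] at hcon
    rcases hC d hcon with ⟨i, hi, h1 | h1⟩ | ⟨i, hi, h1 | h1⟩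
    · have : i = 0 := ha.src_injective hG hxy hi.le (Nat.zero_le _) (by rw [h1, hd])
      subst this
      exact hda h1.symm
    · have : i + 1 = 0 := ha.src_injective hG hxy hi (Nat.zero_le _)
        (by rw [← hsrcrev _ _ _ h1, hd])
      omega
    · have : i = 0 := hb.src_injective hG hxy hi.le (Nat.zero_le _)
        (by rw [h1, hd]; exact ha.src_start.trans hb.src_start.symm)
      subst this
      exact hdb h1.symm
    · have : i + 1 = 0 := hb.src_injective hG hxy hi (Nat.zero_le _)
        (by rw [← hsrcrev _ _ _ h1, hd]; exact ha.src_start.trans hb.src_start.symm)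
      omega
  | succ i ih =>
    refine Relation.ReflTransGen.trans ?_ (ih (by omega))
    have hs := src_facePerm_pow_succ G a i
    -- At an inner vertex, rotate from the outgoing dart of the arc to the reverse of the incoming
    -- one.
    refine sameSide_rotate hs ?_ fun d hd hda hdb => ?_
    · intro heq
      have h1 := congrArg G.rev heq
      rw [G.rev_rev] at h1
      have h2 := G.src_facePerm ((G.facePerm ^ (i + 1)) a)
      rw [h1, ← Equiv.Perm.mul_apply, ← pow_succ'] at h2
      have := ha.src_injective hG hxy (i := i + 1 + 1) (j := i) (by omega) (by omega) h2
      omega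
    · by_contra hcon
      rw [← not_or, not_not] at hcon
      rcases hC d hcon with ⟨k, hk, h1 | h1⟩ | ⟨k, hk, h1 | h1⟩
      · have := ha.src_injective hG hxy hk.le hi.le (by rw [h1, hd])
        subst this
        exact hda h1.symm
      · have := ha.src_injective hG hxy (i := k + 1) hk hi.le (by rw [← hsrcrev _ _ _ h1, hd])
        obtain rfl : k = i := by omega
        exact hdb (by rw [h1, G.rev_rev])
      · exact h.arc_disjoint ha hb (Nat.succ_pos i) hi hk.le (by rw [h1, hd])
      · exact h.arc_disjoint ha hb (Nat.succ_pos i) hi (j := k + 1) hk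
          (by rw [← hsrcrev _ _ _ h1, hd])

/-- The two arcs bound different sides of their cycle. -/
theorem not_sameSide (hG : G.IsTwoConnected) (hn : ∀ d, G.next d ≠ d)
    (h : G.IsTwoSep S x y) (ha : G.IsArc S x y a m) (hb : G.IsArc Sᶜ x y b n)
    {C : Cycle G.D} (hC : ∀ d, d ∈ C ↔
      (∃ i < m, (G.facePerm ^ i) a = d) ∨ ∃ j < n, (G.facePerm ^ j) b = G.rev d)
    (hright : G.SameSide C (G.face (G.rev a)) (G.face b)) :
    ¬ G.SameSide C (G.face a) (G.face b) := by
  classical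
  have : Fintype G.D := Fintype.ofFinite _
  -- The potential of the closed walk is constant on each side but jumps across the edge of `a`,
  -- whose other face is on the side of the face of `b`.
  obtain ⟨p, hp⟩ := G.exists_facePotential (fun d => G.arcInd a m d + G.arcInd b n d) (fun v => by
    have h1 : ∀ d, (if G.src d = v then G.arcInd a m d + G.arcInd b n d +
        (G.arcInd a m (G.rev d) + G.arcInd b n (G.rev d)) else 0) =
        (if G.src d = v then G.arcInd a m d + G.arcInd a m (G.rev d) else 0) +
        (if G.src d = v then G.arcInd b n d + G.arcInd b n (G.rev d) else 0) := by
      intro d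
      split_ifs
      · ring
      · simp
    simp only [h1, Finset.sum_add_distrib, G.sum_arcInd, ha.src_start, ha.src_end, hb.src_start,
      hb.src_end]
    exact CharTwo.add_self_eq_zero _)
  have hzero : ∀ (c : G.D) (k : ℕ) d, (∀ i < k, (G.facePerm ^ i) c ≠ d) → G.arcInd c k d = 0 := by
    intro c k d hd
    exact Finset.sum_eq_zero fun i hi => if_neg (hd i (Finset.mem_range.1 hi))
  have hconst : ∀ f g, G.SameSide C f g → p f = p g := by
    intro f g hfg
    induction hfg with
    | refl => rfl
    | tail _ hadj ih =>
      rw [ih]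
      obtain ⟨d, h1, h2, rfl, rfl⟩ := hadj
      rw [hC, not_or] at h1 h2
      have := hp d
      rw [hzero a m d fun i hi he => h1.1 ⟨i, hi, he⟩,
        hzero b n d fun i hi he => h2.2 ⟨i, hi, by rw [he, G.rev_rev]⟩,
        hzero a m _ fun i hi he => h2.1 ⟨i, hi, he⟩,
        hzero b n _ fun i hi he => h1.2 ⟨i, hi, he⟩] at this
      simp only [add_zero] at this
      exact CharTwo.add_eq_zero.1 this
  intro hcon
  have haS : a ∈ S := ha.mem 0 ha.pos
  have h1 : G.arcInd a m a = 1 := by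
    rw [EmbeddedGraph.arcInd, Finset.sum_eq_single 0]
    · simp
    · intro i hi hi0
      refine if_neg fun he => hi0 ?_
      exact ha.injective (Finset.mem_range.1 hi) ha.pos he
    · intro h0
      exact absurd (Finset.mem_range.2 ha.pos) h0
  have := hp a
  rw [h1, hzero b n a fun i hi he => hb.mem i hi (by rwa [he]),
    hzero b n _ fun i hi he => hb.mem i hi (by rw [he]; exact (h.rev_mem _).2 haS),
    hzero a m _ fun i hi he => face_rev_ne hG hn a (by rw [← he, G.face_pow]),
    hconst _ _ hcon, hconst _ _ hright, CharTwo.add_self_eq_zero] at this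
  simp at this

/-- The faces of `a` and `b` lie on different sides, and every face is on one of these sides. The
edges in `hf` and `hg` are off the cycle, one on each side. -/
theorem isSeparatingCycle_arcCycle (hG : G.IsTwoConnected) (hn : ∀ d, G.next d ≠ d) (hxy : x ≠ y)
    (h : G.IsTwoSep S x y) (ha : G.IsArc S x y a m) (hb : G.IsArc Sᶜ x y b n)
    (hf : ∃ e, G.face e = G.face a ∧ e ∉ S ∧ G.face (G.rev e) ≠ G.face b)
    (hg : ∃ e, G.face e = G.face b ∧ e ∈ S ∧ G.face (G.rev e) ≠ G.face a) :
    G.IsSeparatingCycle (G.arcCycle a b m n) := by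
  set C := G.arcCycle a b m n with hCdef
  have hC : ∀ d, d ∈ C ↔ (∃ i < m, (G.facePerm ^ i) a = d) ∨
      ∃ j < n, (G.facePerm ^ j) b = G.rev d := G.mem_arcCycle a b m n
  have hright : ∀ i < m, G.SameSide C (G.face (G.rev ((G.facePerm ^ i) a))) (G.face b) := by
    intro i hi
    refine sameSide_rev_arc hG hxy h ha hb (fun d hd => ?_) hi
    rcases hd with hd | hd
    · rcases (hC _).1 hd with ⟨i, hi, h1⟩ | ⟨i, hi, h1⟩
      · exact Or.inl ⟨i, hi, Or.inl h1⟩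
      · exact Or.inr ⟨i, hi, Or.inr h1⟩
    · rcases (hC _).1 hd with ⟨i, hi, h1⟩ | ⟨i, hi, h1⟩
      · exact Or.inl ⟨i, hi, Or.inr h1⟩
      · exact Or.inr ⟨i, hi, Or.inl (by rwa [G.rev_rev] at h1)⟩
  have hleft : ∀ j < n, G.SameSide C (G.face (G.rev ((G.facePerm ^ j) b))) (G.face a) := by
    intro i hi
    refine sameSide_rev_arc hG hxy h.compl hb (by rwa [compl_compl]) (fun d hd => ?_) hi
    rcases hd with hd | hd
    · rcases (hC _).1 hd with ⟨i, hi, h1⟩ | ⟨i, hi, h1⟩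
      · exact Or.inr ⟨i, hi, Or.inl h1⟩
      · exact Or.inl ⟨i, hi, Or.inr h1⟩
    · rcases (hC _).1 hd with ⟨i, hi, h1⟩ | ⟨i, hi, h1⟩
      · exact Or.inr ⟨i, hi, Or.inr h1⟩
      · exact Or.inl ⟨i, hi, Or.inl (by rwa [G.rev_rev] at h1)⟩
  have hnot := not_sameSide hG hn h ha hb hC (hright 0 ha.pos)
  have hdich : ∀ d, d ∈ {d | G.SameSide C (G.face d) (G.face a) ∨
      G.SameSide C (G.face d) (G.face b)} := by
    have hrev : ∀ d, (G.SameSide C (G.face d) (G.face a) ∨ G.SameSide C (G.face d) (G.face b)) →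
        (G.SameSide C (G.face (G.rev d)) (G.face a) ∨
          G.SameSide C (G.face (G.rev d)) (G.face b)) := by
      intro d hd
      by_cases h1 : d ∈ C
      · rcases (hC d).1 h1 with ⟨i, hi, rfl⟩ | ⟨i, hi, h2⟩
        · exact Or.inr (hright i hi)
        · rw [← h2, G.face_pow]
          exact Or.inr .refl
      by_cases h2 : G.rev d ∈ C
      · rcases (hC _).1 h2 with ⟨i, hi, h3⟩ | ⟨i, hi, h3⟩
        · rw [← h3, G.face_pow]
          exact Or.inl .refl
        · rw [G.rev_rev] at h3
          subst h3
          exact Or.inl (hleft i hi)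
      have hadj : G.AdjOff C (G.face (G.rev d)) (G.face d) := adjOff_symm ⟨d, h1, h2, rfl, rfl⟩
      exact hd.imp (fun h => .head hadj h) (fun h => .head hadj h)
    refine G.mem_of_closed (x := a) (fun d hd => hrev d hd) (fun d hd => ?_) (Or.inl .refl)
    simpa only [Set.mem_ofPred_eq, G.face_next] using hrev d hd
  have hoff : ∀ e, (G.face e = G.face a ∧ e ∉ S ∧ G.face (G.rev e) ≠ G.face b) ∨
      (G.face e = G.face b ∧ e ∈ S ∧ G.face (G.rev e) ≠ G.face a) → e ∉ C ∧ G.rev e ∉ C := by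
    intro e he
    rw [hC, hC, G.rev_rev]
    have hba : G.face b ≠ G.face a := fun h' => hnot (by rw [h'])
    rcases he with ⟨h1, h2, h3⟩ | ⟨h1, h2, h3⟩
    · refine ⟨?_, ?_⟩
      · rintro (⟨i, hi, rfl⟩ | ⟨i, hi, h4⟩)
        · exact h2 (ha.mem i hi)
        · exact h3 (by rw [← h4, G.face_pow])
      · rintro (⟨i, hi, h4⟩ | ⟨i, hi, rfl⟩)
        · exact h2 ((h.rev_mem _).1 (h4 ▸ ha.mem i hi))
        · exact hba (by rw [← h1, G.face_pow])
    · refine ⟨?_, ?_⟩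
      · rintro (⟨i, hi, rfl⟩ | ⟨i, hi, h4⟩)
        · exact hba (by rw [← h1, G.face_pow])
        · exact hb.mem i hi (h4 ▸ (h.rev_mem _).2 h2)
      · rintro (⟨i, hi, h4⟩ | ⟨i, hi, rfl⟩)
        · exact h3 (by rw [← h4, G.face_pow])
        · exact hb.mem i hi h2
  obtain ⟨e, he⟩ := hf
  obtain ⟨e', he'⟩ := hg
  obtain ⟨he1, he2⟩ := hoff e (Or.inl he)
  obtain ⟨he1', he2'⟩ := hoff e' (Or.inr he')
  refine ⟨isCycle_arcCycle hG hn hxy h ha hb, ?_⟩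
  obtain ⟨d, hd⟩ := G.face_surjective G.outer
  -- Which of the two edges is inside depends on the side containing the outer face.
  rcases hdich d with hout | hout <;> rw [hd] at hout
  · refine ⟨⟨_, Or.inr ⟨e', rfl, he1', he2', ?_⟩⟩, ⟨_, Or.inr ⟨e, rfl, he1, he2, ?_⟩⟩⟩
    · intro ho
      rw [he'.1] at ho
      exact hnot (hout.symm.trans ho)
    · rw [he.1]
      exact hout
  · refine ⟨⟨_, Or.inr ⟨e, rfl, he1, he2, ?_⟩⟩, ⟨_, Or.inr ⟨e', rfl, he1', he2', ?_⟩⟩⟩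
    · intro ho
      rw [he.1] at ho
      exact hnot ((SameSide.symm ho).trans hout)
    · rw [he'.1]
      exact hout

end

end PlaneGraph

/-! ### Short separating cycles from 2-separations -/

namespace PlaneGraph

variable {G : PlaneGraph.{u}}

/-- Every dart of the face `f` in `S` has the face `g` on its other side. -/
def Borders (G : PlaneGraph.{u}) (S : Set G.D) (f g : G.Face) : Prop :=
  ∀ d ∈ S, G.face d = f → G.face (G.rev d) = g

/-- `G` has a separating cycle that is not longer than its largest face. -/
def HasShortSeparatingCycle (G : PlaneGraph.{u}) : Prop :=
  ∃ C : Cycle G.D, G.IsSeparatingCycle C ∧ C.length ≤ G.maxFaceDegree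

section

variable {S : Set G.D} {x y : G.V} {d e : G.D}

theorem ncard_face_add (hG : G.IsTwoConnected) (S : Set G.D) (f : G.Face) :
    {d | G.face d = f ∧ d ∈ S}.ncard + {d | G.face d = f ∧ d ∈ Sᶜ}.ncard ≤ G.maxFaceDegree := by
  refine le_trans (le_of_eq ?_) (faceDegree_le_maxFaceDegree f)
  rw [faceDegree_eq_ncard hG]
  exact Set.ncard_inter_add_ncard_sdiff_eq_ncard {d | G.face d = f} S (Set.toFinite _)

/-- The faces at two changes of side at `x` give two cycles, and the shorter one is short. -/
theorem IsTwoSep.hasShortSeparatingCycle (hG : G.IsTwoConnected) (hn : ∀ d, G.next d ≠ d)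
    (hxy : x ≠ y) (h : G.IsTwoSep S x y) (hd : G.Enters Sᶜ d) (hdx : G.src d = x)
    (he : G.Enters S e) (hex : G.src e = x)
    (h1 : ¬ G.Borders S (G.face d) (G.face e)) (h2 : ¬ G.Borders S (G.face e) (G.face d))
    (h3 : ¬ G.Borders Sᶜ (G.face d) (G.face e)) (h4 : ¬ G.Borders Sᶜ (G.face e) (G.face d)) :
    G.HasShortSeparatingCycle := by
  -- The face of `d` has arcs of length `m` in `Sᶜ` and `n` in `S`; the face of `e` has arcs of
  -- length `k` in `S` and `l` in `Sᶜ`.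
  obtain ⟨m, hm, hd'⟩ := h.compl.exists_isArc hG hd hdx
  rw [compl_compl] at hd'
  obtain ⟨n, hn', -⟩ := h.symm.exists_isArc hG hd' hm.src_end
  obtain ⟨k, hk, he'⟩ := h.exists_isArc hG he hex
  obtain ⟨l, hl, -⟩ := h.compl.symm.exists_isArc hG he' hk.src_end
  simp only [Borders, not_forall] at h1 h2 h3 h4
  obtain ⟨a1, ha1, ha1', ha1''⟩ := h1
  obtain ⟨a2, ha2, ha2', ha2''⟩ := h2
  obtain ⟨a3, ha3, ha3', ha3''⟩ := h3
  obtain ⟨a4, ha4, ha4', ha4''⟩ := h4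
  have s1 := isSeparatingCycle_arcCycle hG hn hxy.symm h.symm hn' hl
    ⟨a3, by rw [G.face_pow, ha3'], ha3, by rwa [G.face_pow]⟩
    ⟨a2, by rw [G.face_pow, ha2'], ha2, by rwa [G.face_pow]⟩
  have s2 := isSeparatingCycle_arcCycle hG hn hxy h hk hm ⟨a4, ha4', ha4, ha4''⟩
    ⟨a1, ha1', ha1, ha1''⟩
  have l1 := hm.length_le
  have l2 := hn'.length_le
  have l3 := hk.length_le
  have l4 := hl.length_le
  rw [G.face_pow] at l2 l4
  have t1 := ncard_face_add hG S (G.face d)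
  have t2 := ncard_face_add hG S (G.face e)
  -- Here `(n + l) + (k + m)` is at most the sum of two face degrees.
  by_cases hle : n + l ≤ G.maxFaceDegree
  · exact ⟨_, s1, by rwa [length_arcCycle]⟩
  · exact ⟨_, s2, by rw [length_arcCycle]; omega⟩

/-- The two edges at the angle of `d` are the obstacles: if the face of `e` were across one of them,
its single visit to the vertex would make `e` adjacent to `d` in the rotation. -/
theorem not_borders_of_next_ne (hG : G.IsTwoConnected) (hd : G.Enters Sᶜ d)
    (hde : G.src d = G.src e) (h1 : e ≠ G.next d) (h2 : d ≠ G.next e) :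
    ¬ G.Borders S (G.face d) (G.face e) ∧ ¬ G.Borders Sᶜ (G.face d) (G.face e) := by
  constructor
  · intro h
    have h3 := h _ (not_not.1 hd.2) (by
      rw [← G.face_facePerm (G.facePerm.symm d), Equiv.apply_symm_apply])
    rw [facePerm_symm_apply, G.rev_rev] at h3
    apply h2
    rw [← G.eq_of_face_eq_of_src_eq hG h3 (by
      rw [← hde, ← G.src_next, Equiv.apply_symm_apply]), Equiv.apply_symm_apply]
  · intro h
    have h3 := h d hd.1 rfl
    rw [← G.face_next] at h3
    exact h1 (G.eq_of_face_eq_of_src_eq hG h3 (by rw [G.src_next, hde])).symm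

theorem IsTwoSep.hasShortSeparatingCycle_of_next_ne (hG : G.IsTwoConnected)
    (hn : ∀ d, G.next d ≠ d) (hxy : x ≠ y) (h : G.IsTwoSep S x y) (hd : G.Enters Sᶜ d)
    (hdx : G.src d = x) (he : G.Enters S e) (hex : G.src e = x) (h1 : e ≠ G.next d)
    (h2 : d ≠ G.next e) : G.HasShortSeparatingCycle := by
  obtain ⟨a1, a2⟩ := not_borders_of_next_ne hG hd (hdx.trans hex.symm) h1 h2
  obtain ⟨a3, a4⟩ := not_borders_of_next_ne (S := Sᶜ) hG (by rwa [compl_compl])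
    (hex.trans hdx.symm) h2 h1
  rw [compl_compl] at a4
  exact h.hasShortSeparatingCycle hG hn hxy hd hdx he hex a1 a4 a2 a3

/-- A change of side in the rotation is one in face tracing, since `rev z` is traced just before
`next z`. -/
theorem IsTwoSep.exists_enters (h : G.IsTwoSep S x y) {a b : G.D} (ha : a ∈ S) (hb : b ∉ S)
    (hab : G.src a = G.src b) : ∃ c, G.Enters Sᶜ c ∧ G.src c = G.src a := by
  obtain ⟨z, hz, hz', hs⟩ := G.exists_mem_next_notMem ha hb hab
  refine ⟨G.next z, ⟨hz', ?_⟩, by rw [G.src_next, hs]⟩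
  rw [facePerm_symm_apply, Equiv.symm_apply_apply, Set.mem_compl_iff, not_not, h.rev_mem]
  exact hz

/-- Two faces meeting at two vertices, but not next to each other at one of them, yield a short
separating cycle. -/
theorem hasShortSeparatingCycle_of_common_vertices (hG : G.IsTwoConnected)
    (hn : ∀ d, G.next d ≠ d) (hxy : x ≠ y) {d' e' : G.D} (hd : G.src d = x) (he : G.src e = x)
    (hd' : G.src d' = y) (he' : G.src e' = y) (hf : G.face d = G.face d')
    (hg : G.face e = G.face e') (hne : d ≠ e) (h1 : e ≠ G.next d) (h2 : d ≠ G.next e) :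
    G.HasShortSeparatingCycle := by
  classical
  have : Fintype G.D := Fintype.ofFinite _
  obtain ⟨m, hm⟩ := ((G.face_eq_iff _ _).1 hf).exists_nat_pow_eq
  obtain ⟨n, hn'⟩ := ((G.face_eq_iff _ _).1 hg).exists_nat_pow_eq
  -- This models a closed curve through the two faces that meets the graph only at `x` and `y`; the
  -- edges on its two sides form a 2-separation.
  obtain ⟨H, hr, hφ⟩ := G.exists_dartPotential (fun z => G.arcInd d m z + G.arcInd e n z)
    (fun v => by
      have h1 : ∀ z, (if G.src z = v then G.arcInd d m z + G.arcInd e n z +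
          (G.arcInd d m (G.rev z) + G.arcInd e n (G.rev z)) else 0) =
          (if G.src z = v then G.arcInd d m z + G.arcInd d m (G.rev z) else 0) +
          (if G.src z = v then G.arcInd e n z + G.arcInd e n (G.rev z) else 0) := by
        intro z
        split_ifs
        · ring
        · simp
      simp only [h1, Finset.sum_add_distrib, G.sum_arcInd, hm, hn', hd, he, hd', he']
      exact CharTwo.add_self_eq_zero _)
  have hjump : ∀ z, H (G.next z) = H z + (((if d = G.next z then 1 else 0) +
      (if d' = G.next z then 1 else 0)) + ((if e = G.next z then 1 else 0) +
      (if e' = G.next z then 1 else 0))) := by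
    intro z
    have := hφ (G.rev z)
    rw [add_add_add_comm, G.arcInd_add_arcInd_facePerm, G.arcInd_add_arcInd_facePerm,
      G.facePerm_apply, G.rev_rev, hr, hm, hn'] at this
    exact this
  set S : Set G.D := {z | H z = H d} with hS
  have hSsep : G.IsTwoSep S x y := by
    refine ⟨fun z => by simp [hS, hr], fun a ha b hb hab => ?_⟩
    obtain ⟨z, hz, hz', hzs⟩ := G.exists_mem_next_notMem ha hb hab
    by_contra hcon
    rw [← hzs, ← G.src_next, not_or] at hcon
    apply hz'
    have h3 := hjump z
    rw [if_neg (by rintro rfl; exact hcon.1 hd), if_neg (by rintro rfl; exact hcon.2 hd'),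
      if_neg (by rintro rfl; exact hcon.1 he), if_neg (by rintro rfl; exact hcon.2 he')] at h3
    simp only [add_zero] at h3
    exact h3.trans hz
  have hdd' : d' ≠ d := by rintro rfl; exact hxy (hd.symm.trans hd')
  have hde' : e' ≠ d := by rintro rfl; exact hxy (hd.symm.trans he')
  have hprev : G.next.symm d ∉ S := by
    intro hmem
    have h3 := hjump (G.next.symm d)
    have h4 : H (G.next.symm d) = H d := hmem
    rw [Equiv.apply_symm_apply, if_pos rfl, if_neg hdd', if_neg hne.symm, if_neg hde', h4] at h3
    simp at h3
  have hdS : G.Enters S d := ⟨rfl, by rwa [facePerm_symm_apply, hSsep.rev_mem]⟩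
  obtain ⟨c, hc, hcs⟩ := hSsep.exists_enters (a := d) (b := G.next.symm d) rfl hprev
    (by rw [← G.src_next (G.next.symm d), Equiv.apply_symm_apply])
  -- At `x` the side changes only at the angles of `d` and `e`, and at `d` it changes into `S`.
  have hce : c = e := by
    by_contra hce
    have h3 := hjump (G.next.symm c)
    have h4 : H (G.next.symm c) = H d := by
      have := hc.2
      rw [facePerm_symm_apply, Set.mem_compl_iff, not_not, hSsep.rev_mem] at this
      exact this
    have hcx := hcs.trans hd
    rw [Equiv.apply_symm_apply, if_neg (by rintro rfl; exact hc.1 rfl),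
      if_neg (by rintro rfl; exact hxy (hcx.symm.trans hd')), if_neg (Ne.symm hce),
      if_neg (by rintro rfl; exact hxy (hcx.symm.trans he')), h4] at h3
    simp only [add_zero] at h3
    exact hc.1 h3
  subst hce
  exact hSsep.hasShortSeparatingCycle_of_next_ne hG hn hxy hc he hdS hd h2 h1

/-- Each run of `S` in the rotation begins with an entering dart; the only run begins at `e` and
stops there. -/
theorem IsTwoSep.eq_of_enters_unique (h : G.IsTwoSep S x y)
    (huniq : ∀ c, G.src c = G.src e → G.Enters S c → c = e) (hnext : G.next e ∉ S) {z : G.D}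
    (hz : z ∈ S) (hze : G.src z = G.src e) : z = e := by
  by_contra hne
  obtain ⟨t, ht, ht', hts⟩ := G.exists_mem_next_notMem (S := {w | w ∈ S ∧ w ≠ e}ᶜ) (x := e) (y := z)
    (fun h => h.2 rfl) (fun h => h ⟨hz, hne⟩) hze.symm
  rw [Set.mem_compl_iff, not_not] at ht'
  have htS : t ∈ S := by
    by_contra htS
    refine ht'.2 (huniq _ (by rw [G.src_next, hts]) ⟨ht'.1, ?_⟩)
    rwa [facePerm_symm_apply, Equiv.symm_apply_apply, h.rev_mem]
  refine hnext (?_ : G.next e ∈ S)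
  have hte : t = e := by
    by_contra hte
    exact ht ⟨htS, hte⟩
  rw [hte] at ht'
  exact ht'.left

/-- If the side `S` has a single angle at `x` and the faces `f` and `g` on both sides of it border
each other along all of `f ∩ S`, then `S` is a path. -/
theorem IsTwoSep.ncard_lt (hG : G.IsTwoConnected) (hxy : x ≠ y) (h : G.IsTwoSep S x y)
    (hd : G.Enters Sᶜ d) (hdx : G.src d = x) (he : G.Enters S e) (hex : G.src e = x)
    (hdu : ∀ c, G.src c = x → G.Enters Sᶜ c → c = d) (heu : ∀ c, G.src c = x → G.Enters S c → c = e)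
    (hb : G.Borders S (G.face d) (G.face e)) : S.ncard < 2 * (G.src '' S).ncard := by
  obtain ⟨m, hm, hd'⟩ := h.compl.exists_isArc hG hd hdx
  rw [compl_compl] at hd'
  set d' := (G.facePerm ^ m) d with hd'def
  have hd'f : G.face d' = G.face d := G.face_pow _ _
  obtain ⟨k, hk, he'⟩ := h.exists_isArc hG he hex
  have hpd : G.facePerm.symm d ∈ S := not_not.1 hd.2
  have hpdf : G.face (G.facePerm.symm d) = G.face d := by
    rw [← G.face_facePerm (G.facePerm.symm d), Equiv.apply_symm_apply]
  have hprev : G.next.symm d = e := by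
    have h3 := hb _ hpd hpdf
    rw [facePerm_symm_apply, G.rev_rev] at h3
    exact G.eq_of_face_eq_of_src_eq hG h3 (by
      rw [hex, ← hdx, ← G.src_next, Equiv.apply_symm_apply])
  have hrevE : G.rev e ∈ S ∧ G.face (G.rev e) = G.face d := by
    rw [← hprev, ← facePerm_symm_apply]
    exact ⟨hpd, hpdf⟩
  have hnextE : G.next e ∉ S := by
    rw [← hprev, Equiv.apply_symm_apply]
    exact hd.1
  have hxonly : ∀ z ∈ S, G.src z = x → z = e := fun z hz hzx =>
    h.eq_of_enters_unique (fun c hc => heu c (hc.trans hex)) hnextE hz (hzx.trans hex.symm)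
  have hnextD' : G.next d' ∉ S := by
    have h3 := hb d' hd'.1 hd'f
    rw [← G.face_next] at h3
    have : G.next d' = (G.facePerm ^ k) e :=
      G.eq_of_face_eq_of_src_eq hG (by rw [h3, G.face_pow])
        (by rw [G.src_next, hm.src_end, hk.src_end])
    rw [this]
    exact he'.1
  have hyonly : ∀ z ∈ S, G.src z = y → z = d' := by
    intro z hz hzy
    refine h.eq_of_enters_unique (fun c hc hcS => ?_) hnextD' hz (hzy.trans hm.src_end.symm)
    obtain ⟨l, hl, hc'⟩ := h.symm.exists_isArc hG hcS (hc.trans hm.src_end)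
    have := hdu _ hl.src_end hc'
    refine G.eq_of_face_eq_of_src_eq hG ?_ hc
    rw [hd'f, ← this, G.face_pow]
  set X : Set G.D := {z | z ∈ S ∧ G.face z = G.face d} with hX
  set Y : Set G.D := {z | z ∈ X ∨ G.rev z ∈ X} with hY
  -- At an inner vertex of `f ∩ S` both neighbouring edges of the face have `g` across; as `g`
  -- passes only once, the vertex has degree two.
  have hYnext : ∀ z ∈ Y, G.src z ≠ x → G.src z ≠ y → G.next z ∈ Y := by
    intro z hz hzx hzy
    have hside : ∀ w, G.src w = G.src z → (w ∈ S ↔ z ∈ S) := by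
      intro w hw
      constructor
      · intro hwS
        by_contra hzS
        rcases h.boundary w hwS z hzS hw with h' | h'
        · exact hzx (hw ▸ h')
        · exact hzy (hw ▸ h')
      · intro hzS
        by_contra hwS
        rcases h.boundary z hzS w hwS hw.symm with h' | h'
        · exact hzx h'
        · exact hzy h'
    rcases hz with hz | hz
    · have hpz : G.src (G.next.symm z) = G.src z := by
        rw [← G.src_next, Equiv.apply_symm_apply]
      have ht : G.facePerm.symm z ∈ X := by
        refine ⟨?_, ?_⟩
        · rw [facePerm_symm_apply, h.rev_mem, hside _ hpz]
          exact hz.1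
        · rw [← hz.2, ← G.face_facePerm (G.facePerm.symm z), Equiv.apply_symm_apply]
      have h3 := hb _ ht.1 ht.2
      rw [facePerm_symm_apply, G.rev_rev] at h3
      have h4 : G.next z = G.next.symm z := by
        refine G.eq_of_face_eq_of_src_eq hG ?_ (by rw [G.src_next, hpz])
        rw [h3, G.face_next, hb z hz.1 hz.2]
      right
      rw [h4, ← facePerm_symm_apply]
      exact ht
    · left
      refine ⟨(hside _ (G.src_next z)).2 ((h.rev_mem z).1 hz.1), ?_⟩
      rw [G.face_next, hz.2]
  have hSY : S ⊆ Y := by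
    intro z hz
    by_contra hzY
    -- At `x` and `y` the part `S` has one dart each, in `Y`. The rest of `S` would be a union of
    -- components.
    have hZ : d ∈ {w | w ∈ S ∧ w ∉ Y} := by
      refine G.mem_of_connected G.connected (S := {w | w ∈ S ∧ w ∉ Y}) (x := z) ?_ ?_ ⟨hz, hzY⟩ d
      · rintro w ⟨hw, hwY⟩
        refine ⟨(h.rev_mem w).2 hw, fun h' => hwY ?_⟩
        rcases h' with h' | h'
        · exact Or.inr h'
        · rw [G.rev_rev] at h'
          exact Or.inl h'
      · rintro w ⟨hw, hwY⟩ t hwt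
        have hwx : G.src w ≠ x := fun h' => hwY (by
          rw [hxonly w hw h']
          exact Or.inr hrevE)
        have hwy : G.src w ≠ y := fun h' => hwY (by
          rw [hyonly w hw h']
          exact Or.inl ⟨hd'.1, hd'f⟩)
        refine ⟨?_, fun htY => ?_⟩
        · by_contra htS
          rcases h.boundary w hw t htS hwt with h' | h'
          · exact hwx h'
          · exact hwy h'
        · obtain ⟨s, hs, hs', hst⟩ := G.exists_mem_next_notMem htY hwY hwt.symm
          exact hs' (hYnext s hs (by rwa [hst, ← hwt]) (by rwa [hst, ← hwt]))
    exact hd.1 hZ.1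
  have hfg : G.face e ≠ G.face d := fun h' => hd.1 (by
    rw [← G.eq_of_face_eq_of_src_eq hG h' (hex.trans hdx.symm)]
    exact he.1)
  have c1 : S.ncard ≤ X.ncard + X.ncard := by
    calc S.ncard ≤ (X ∪ G.rev '' X).ncard := by
          apply Set.ncard_le_ncard _ (Set.toFinite _)
          intro z hz
          rcases hSY hz with h' | h'
          · exact Or.inl h'
          · exact Or.inr ⟨_, h', G.rev_rev z⟩
      _ ≤ X.ncard + (G.rev '' X).ncard := Set.ncard_union_le _ _
      _ ≤ X.ncard + X.ncard := Nat.add_le_add_left (Set.ncard_image_le (Set.toFinite _)) _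
  -- The sources of `X` are distinct and miss `x`, where the only dart of `S` is `e`, on the other
  -- face.
  have c2 : X.ncard + 1 ≤ (G.src '' S).ncard := by
    have hinj : Set.InjOn G.src X := fun z hz w hw hzw =>
      G.eq_of_face_eq_of_src_eq hG (hz.2.trans hw.2.symm) hzw
    rw [← hinj.ncard_image, ← Set.ncard_insert_of_notMem (a := x) _ (Set.toFinite _)]
    · apply Set.ncard_le_ncard _ (Set.toFinite _)
      rintro v (rfl | ⟨z, hz, rfl⟩)
      · exact ⟨e, he.1, hex⟩
      · exact ⟨z, hz.1, rfl⟩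
    · rintro ⟨z, hz, hzx⟩
      apply hfg
      rw [← hxonly z hz.1 hzx, hz.2]
  omega

end

/-- A partition of the edges into two parts that share at most two vertices and are not paths (each
has at least as many edges as vertices). -/
def IsDegenerate (G : PlaneGraph.{u}) : Prop :=
  ∃ (S : Set G.D) (x y : G.V), G.IsTwoSep S x y ∧ S.Nonempty ∧ Sᶜ.Nonempty ∧
    2 * (G.src '' S).ncard ≤ S.ncard ∧ 2 * (G.src '' Sᶜ).ncard ≤ Sᶜ.ncard

/-- Two faces entering the same part at `x` are not next to each other there and meet again at `y`,
giving a short cycle. Otherwise each part has one angle at `x` and at `y`, and the counts forbid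
paths. -/
theorem IsDegenerate.hasShortSeparatingCycle (hG : G.IsTwoConnected) (hn : ∀ d, G.next d ≠ d)
    (hdeg : G.IsDegenerate) : G.HasShortSeparatingCycle := by
  obtain ⟨S, x, y, h, ⟨p, hp⟩, ⟨q, hq⟩, c1, c2⟩ := hdeg
  have hboth : ∀ x y, G.IsTwoSep S x y → ∃ a ∈ S, ∃ b ∉ S, G.src a = x ∧ G.src b = x := by
    intro x y h
    by_contra! hcon
    refine hq (G.mem_of_isTwoConnected hG y h.rev_mem (fun a ha b hb hab => ?_) hp q)
    exact (h.boundary a ha b hb hab).resolve_left fun h' => hcon a ha b hb h' (hab ▸ h')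
  have hxy : x ≠ y := by
    rintro rfl
    exact hq (G.mem_of_isTwoConnected hG x h.rev_mem
      (fun a ha b hb hab => (h.boundary a ha b hb hab).elim id id) hp q)
  obtain ⟨a, ha, b, hb, hax, hbx⟩ := hboth x y h
  obtain ⟨d, hd, hds⟩ := h.exists_enters ha hb (hax.trans hbx.symm)
  obtain ⟨e, he, hes⟩ := h.compl.exists_enters (a := b) (b := a) hb (fun h' => h' ha)
    (hbx.trans hax.symm)
  rw [compl_compl] at he
  have hdx := hds.trans hax
  have hex := hes.trans hbx
  by_contra hno
  have hdu : ∀ c, G.src c = x → G.Enters Sᶜ c → c = d := by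
    intro c hc hcS
    by_contra hne
    obtain ⟨m, hm, -⟩ := h.compl.exists_isArc hG hd hdx
    obtain ⟨k, hk, -⟩ := h.compl.exists_isArc hG hcS hc
    refine hno (hasShortSeparatingCycle_of_common_vertices hG hn hxy hc hdx hk.src_end hm.src_end
      (G.face_pow _ _).symm (G.face_pow _ _).symm hne ?_ ?_)
    · rintro rfl
      have := hd.2
      rw [facePerm_symm_apply, Equiv.symm_apply_apply, h.compl.rev_mem] at this
      exact this hcS.1
    · rintro rfl
      have := hcS.2
      rw [facePerm_symm_apply, Equiv.symm_apply_apply, h.compl.rev_mem] at this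
      exact this hd.1
  have heu : ∀ c, G.src c = x → G.Enters S c → c = e := by
    intro c hc hcS
    by_contra hne
    obtain ⟨m, hm, -⟩ := h.exists_isArc hG he hex
    obtain ⟨k, hk, -⟩ := h.exists_isArc hG hcS hc
    refine hno (hasShortSeparatingCycle_of_common_vertices hG hn hxy hc hex hk.src_end hm.src_end
      (G.face_pow _ _).symm (G.face_pow _ _).symm hne ?_ ?_)
    · rintro rfl
      have := he.2
      rw [facePerm_symm_apply, Equiv.symm_apply_apply, h.rev_mem] at this
      exact this hcS.1
    · rintro rfl
      have := hcS.2
      rw [facePerm_symm_apply, Equiv.symm_apply_apply, h.rev_mem] at this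
      exact this he.1
  obtain ⟨m, hm, hd'⟩ := h.compl.exists_isArc hG hd hdx
  rw [compl_compl] at hd'
  obtain ⟨k, hk, he'⟩ := h.exists_isArc hG he hex
  -- Uniqueness is carried from `x` to `y` along the faces.
  have hdu' : ∀ c, G.src c = y → G.Enters S c → c = (G.facePerm ^ m) d := by
    intro c hc hcS
    obtain ⟨l, hl, hl'⟩ := h.symm.exists_isArc hG hcS hc
    refine G.eq_of_face_eq_of_src_eq hG ?_ (hc.trans hm.src_end.symm)
    rw [G.face_pow, ← hdu _ hl.src_end hl', G.face_pow]
  have heu' : ∀ c, G.src c = y → G.Enters Sᶜ c → c = (G.facePerm ^ k) e := by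
    intro c hc hcS
    obtain ⟨l, hl, hl'⟩ := h.compl.symm.exists_isArc hG hcS hc
    rw [compl_compl] at hl'
    refine G.eq_of_face_eq_of_src_eq hG ?_ (hc.trans hk.src_end.symm)
    rw [G.face_pow, ← heu _ hl.src_end hl', G.face_pow]
  refine hno (h.hasShortSeparatingCycle hG hn hxy hd hdx he hex ?_ ?_ ?_ ?_) <;> intro hB
  · exact absurd c1 (not_le.2 (h.ncard_lt hG hxy hd hdx he hex hdu heu hB))
  · exact absurd c1 (not_le.2 (h.symm.ncard_lt hG hxy.symm he' hk.src_end hd' hm.src_end heu' hdu'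
      (by rwa [G.face_pow, G.face_pow])))
  · exact absurd c2 (not_le.2 (h.compl.symm.ncard_lt hG hxy.symm (by rwa [compl_compl]) hm.src_end
      he' hk.src_end (by rwa [compl_compl]) heu' (by rwa [G.face_pow, G.face_pow])))
  · exact absurd c2 (not_le.2 (h.compl.ncard_lt hG hxy (by rwa [compl_compl]) hex hd hdx
      (by rwa [compl_compl]) hdu hB))

end PlaneGraph

/-! ### Degeneracy under subdivision and from parallel edges -/

namespace PlaneGraph

/-- The part of the subdivided edge gains one vertex and two darts; the other part keeps its counts.
-/
theorem IsDegenerate.of_isEdgeSubdivision {G H : PlaneGraph.{u}} (hGH : G.IsEdgeSubdivision H)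
    (hdeg : G.IsDegenerate) : H.IsDegenerate := by
  obtain ⟨fV, fD, d, hsrc, hsa, hsb, hra, hrb, hrev, -, -⟩ := hGH
  have key : ∀ (S : Set G.D) x y, d ∈ S → G.IsTwoSep S x y → Sᶜ.Nonempty →
      2 * (G.src '' S).ncard ≤ S.ncard → 2 * (G.src '' Sᶜ).ncard ≤ Sᶜ.ncard → H.IsDegenerate := by
    intro S x y hd h hne c1 c2
    set T : Set H.D := fD '' (Sum.inl '' S ∪ Set.range Sum.inr) with hT
    have hTl : ∀ z, fD (Sum.inl z) ∈ T ↔ z ∈ S := by simp [hT]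
    have hTr : ∀ b, fD (Sum.inr b) ∈ T := by simp [hT]
    have hTc : Tᶜ = (fun z => fD (Sum.inl z)) '' Sᶜ := by
      ext z
      obtain ⟨z | z, rfl⟩ := fD.surjective z
      · simp [hTl]
      · simp [hTr]
    have hinj : Function.Injective fun z => fD (Sum.inl z : G.D ⊕ Bool) :=
      fD.injective.comp Sum.inl_injective
    have hinjV : Function.Injective fun v => fV (some v) :=
      fV.injective.comp (Option.some_injective _)
    have hra' : H.rev (fD (Sum.inr false)) = fD (Sum.inl d) := by rw [← hra, H.rev_rev]
    have hrb' : H.rev (fD (Sum.inr true)) = fD (Sum.inl (G.rev d)) := by rw [← hrb, H.rev_rev]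
    have hd' : G.rev d ∈ S := (h.rev_mem d).2 hd
    refine ⟨T, fV (some x), fV (some y), ⟨?_, ?_⟩, ⟨_, hTr true⟩, ?_, ?_, ?_⟩
    · intro z
      obtain ⟨z | b, rfl⟩ := fD.surjective z
      · by_cases h1 : z = d
        · subst h1
          rw [hra]
          simp [hTl, hTr, hd]
        by_cases h2 : z = G.rev d
        · subst h2
          rw [hrb]
          simp [hTl, hTr, hd']
        rw [hrev z h1 h2, hTl, hTl, h.rev_mem]
      · cases b
        · rw [hra']
          simp [hTl, hTr, hd]
        · rw [hrb']
          simp [hTl, hTr, hd']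
    · intro z hz t ht hzt
      obtain ⟨t | b, rfl⟩ := fD.surjective t
      swap
      · exact absurd (hTr b) ht
      rw [hsrc] at hzt
      obtain ⟨z | b, rfl⟩ := fD.surjective z
      · rw [hsrc] at hzt ⊢
        rcases h.boundary z ((hTl z).1 hz) t (fun h' => ht ((hTl t).2 h')) (hinjV hzt) with h' | h'
        · exact Or.inl (by rw [h'])
        · exact Or.inr (by rw [h'])
      · cases b
        · rw [hsa] at hzt
          simp at hzt
        · rw [hsb] at hzt
          simp at hzt
    · rw [hTc]
      exact hne.image _
    · have e1 : T.ncard = S.ncard + 2 := by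
        rw [hT, Set.ncard_image_of_injective _ fD.injective, Set.ncard_union_eq _ (Set.toFinite _)
          (Set.toFinite _), Set.ncard_image_of_injective _ Sum.inl_injective, ← Set.image_univ,
          Set.ncard_image_of_injective _ Sum.inr_injective, Set.ncard_univ]
        · simp
        · rw [Set.disjoint_left]
          rintro _ ⟨z, -, rfl⟩ ⟨b, hb⟩
          simp at hb
      have e2 : (H.src '' T).ncard ≤ (G.src '' S).ncard + 1 := by
        calc _ ≤ (insert (fV none) ((fun v => fV (some v)) '' (G.src '' S))).ncard := by
              apply Set.ncard_le_ncard _ (Set.toFinite _)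
              rintro _ ⟨z, hz, rfl⟩
              obtain ⟨z | b, rfl⟩ := fD.surjective z
              · exact Or.inr ⟨_, ⟨z, (hTl z).1 hz, rfl⟩, (hsrc z).symm⟩
              · cases b
                · exact Or.inl hsa
                · exact Or.inl hsb
          _ ≤ ((fun v => fV (some v)) '' (G.src '' S)).ncard + 1 := Set.ncard_insert_le _ _
          _ = _ := by rw [Set.ncard_image_of_injective _ hinjV]
      omega
    · rw [hTc, Set.ncard_image_of_injective _ hinj]
      have : H.src '' ((fun z => fD (Sum.inl z)) '' Sᶜ) = (fun v => fV (some v)) '' (G.src '' Sᶜ) := by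
        rw [Set.image_image, Set.image_image]
        exact Set.image_congr fun z _ => hsrc z
      rw [this, Set.ncard_image_of_injective _ hinjV]
      exact c2
  obtain ⟨S, x, y, h, h1, h2, c1, c2⟩ := hdeg
  by_cases hd : d ∈ S
  · exact key S x y hd h h2 c1 c2
  · exact key Sᶜ x y hd h.compl (by rwa [compl_compl]) c2 (by rwa [compl_compl])

theorem card_darts_add (G : PlaneGraph.{u}) :
    2 * Nat.card G.V + 2 * Nat.card G.Face = Nat.card G.D + 4 := by
  have h1 := G.card_darts
  have h2 := G.euler
  omega

/-- The faces of a subdivision are those of the original graph. -/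
theorem IsEdgeSubdivision.card {G H : PlaneGraph.{u}} (h : G.IsEdgeSubdivision H) :
    Nat.card H.D = Nat.card G.D + 2 ∧ Nat.card H.Face = Nat.card G.Face := by
  obtain ⟨fV, fD, -⟩ := h
  have h1 := G.card_darts_add
  have h2 := H.card_darts_add
  have h3 : Nat.card H.D = Nat.card G.D + 2 := by
    rw [← Nat.card_congr fD, Nat.card_sum]
    simp
  have h4 : Nat.card H.V = Nat.card G.V + 1 := by
    rw [← Nat.card_congr fV, Finite.card_option]
  exact ⟨h3, by omega⟩

/-- Two parallel edges in a plane graph with at least four faces. -/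
theorem isDegenerate_of_parallel (G : PlaneGraph.{u}) (hF : 4 ≤ Nat.card G.Face) {d e : G.D}
    (hne : d ≠ e) (h1 : G.src d = G.src e) (h2 : G.src (G.rev d) = G.src (G.rev e)) :
    G.IsDegenerate := by
  set S : Set G.D := {d, e, G.rev d, G.rev e} with hS
  have hSc : S.ncard = 4 := by
    have n1 : d ≠ G.rev d := (G.rev_ne d).symm
    have n2 : d ≠ G.rev e := by
      rintro h
      exact G.loopless e (by rw [← h, h1])
    have n3 : e ≠ G.rev d := by
      rintro h
      exact G.loopless d (by rw [← h, h1])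
    have n4 : e ≠ G.rev e := (G.rev_ne e).symm
    have n5 : G.rev d ≠ G.rev e := fun h => hne (G.rev_injective h)
    rw [hS, Set.ncard_insert_of_notMem (by simp [hne, n1, n2]) (Set.toFinite _),
      Set.ncard_insert_of_notMem (by simp [n3, n4]) (Set.toFinite _), Set.ncard_pair n5]
  have hsrc : ∀ z ∈ S, G.src z = G.src d ∨ G.src z = G.src (G.rev d) := by
    rintro z (rfl | rfl | rfl | rfl)
    · exact Or.inl rfl
    · exact Or.inl h1.symm
    · exact Or.inr rfl
    · exact Or.inr h2.symm
  have hc := Set.ncard_add_ncard_compl S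
  have hD := G.card_darts_add
  have hV : (G.src '' Sᶜ).ncard ≤ Nat.card G.V := Set.ncard_le_card _
  have hV' : 0 < Nat.card G.V := by
    have : Nonempty G.V := ⟨G.src d⟩
    exact Nat.card_pos
  -- With four faces Euler's formula gives at least `2|V| + 4` darts, and `S` takes four of them.
  have hcard : 2 * (G.src '' Sᶜ).ncard ≤ Sᶜ.ncard := by omega
  refine ⟨S, G.src d, G.src (G.rev d), ⟨?_, fun z hz _ _ _ => hsrc z hz⟩, ⟨d, Or.inl rfl⟩, ?_, ?_,
    hcard⟩
  · have hr : ∀ z ∈ S, G.rev z ∈ S := by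
      rintro z (rfl | rfl | rfl | rfl) <;> simp [hS, G.rev_rev]
    exact fun z => ⟨fun hz => by simpa [G.rev_rev] using hr _ hz, hr z⟩
  · apply Set.nonempty_of_ncard_ne_zero
    omega
  · have : (G.src '' S).ncard ≤ 2 := by
      refine (Set.ncard_le_ncard (t := {G.src d, G.src (G.rev d)}) ?_ (Set.toFinite _)).trans
        ((Set.ncard_insert_le _ _).trans (by simp))
      rintro _ ⟨z, hz, rfl⟩
      exact hsrc z hz
    omega

end PlaneGraph

/-! ### Suppressing a vertex of degree two -/

namespace EmbeddedGraph

/-- The dart `e` leaves a vertex of degree two with two different neighbours. -/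
structure IsSuppressible (H : EmbeddedGraph.{u}) (e : H.D) : Prop where
  next_next : H.next (H.next e) = e
  next_ne : H.next e ≠ e
  src_ne : H.src (H.rev e) ≠ H.src (H.rev (H.next e))

section

variable {H : EmbeddedGraph.{u}} {e : H.D}

theorem IsSuppressible.eq_or_eq (h : H.IsSuppressible e) {d : H.D} (hd : H.src d = H.src e) :
    d = e ∨ d = H.next e := by
  by_contra hcon
  obtain ⟨z, hz, hz', -⟩ := H.exists_mem_next_notMem (S := {e, H.next e}) (x := e) (y := d)
    (Or.inl rfl) hcon hd.symm
  rcases hz with rfl | rfl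
  · exact hz' (Or.inr rfl)
  · exact hz' (Or.inl h.next_next)

open Classical in
/-- Reversal of darts once the source of `e` is suppressed. -/
noncomputable def suppressRev (H : EmbeddedGraph.{u}) (e d : H.D) : H.D :=
  if H.rev d = e then H.rev (H.next e) else if H.rev d = H.next e then H.rev e else H.rev d

theorem suppressRev_of_eq {d : H.D} (hd : H.rev d = e) :
    H.suppressRev e d = H.rev (H.next e) := if_pos hd

theorem IsSuppressible.suppressRev_of_eq_next (h : H.IsSuppressible e) {d : H.D}
    (hd : H.rev d = H.next e) : H.suppressRev e d = H.rev e := by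
  rw [suppressRev, if_neg (by rw [hd]; exact h.next_ne), if_pos hd]

theorem suppressRev_of_ne {d : H.D} (h1 : H.rev d ≠ e) (h2 : H.rev d ≠ H.next e) :
    H.suppressRev e d = H.rev d := by
  rw [suppressRev, if_neg h1, if_neg h2]

theorem IsSuppressible.src_suppressRev_ne (h : H.IsSuppressible e) (d : H.D) :
    H.src (H.suppressRev e d) ≠ H.src e := by
  by_cases h1 : H.rev d = e
  · rw [suppressRev_of_eq h1, ← H.src_next e]
    exact H.loopless _
  by_cases h2 : H.rev d = H.next e
  · rw [h.suppressRev_of_eq_next h2]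
    exact H.loopless _
  rw [suppressRev_of_ne h1 h2]
  exact fun h3 => (h.eq_or_eq h3).elim h1 h2

theorem IsSuppressible.suppressRev_suppressRev (h : H.IsSuppressible e) (d : H.D)
    (hd : H.src d ≠ H.src e) : H.suppressRev e (H.suppressRev e d) = d := by
  by_cases h1 : H.rev d = e
  · rw [suppressRev_of_eq h1, h.suppressRev_of_eq_next (H.rev_rev _), ← h1, H.rev_rev]
  by_cases h2 : H.rev d = H.next e
  · rw [h.suppressRev_of_eq_next h2, suppressRev_of_eq (H.rev_rev _), ← h2, H.rev_rev]
  rw [suppressRev_of_ne h1 h2, suppressRev_of_ne, H.rev_rev]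
  · rw [H.rev_rev]
    rintro rfl
    exact hd rfl
  · rw [H.rev_rev]
    rintro rfl
    exact hd (H.src_next e)

theorem IsSuppressible.src_suppressRev_ne_src (h : H.IsSuppressible e) (d : H.D) :
    H.src (H.suppressRev e d) ≠ H.src d := by
  by_cases h1 : H.rev d = e
  · have : d = H.rev e := by rw [← h1, H.rev_rev]
    rw [suppressRev_of_eq h1, this]
    exact h.src_ne.symm
  by_cases h2 : H.rev d = H.next e
  · have : d = H.rev (H.next e) := by rw [← h2, H.rev_rev]
    rw [h.suppressRev_of_eq_next h2, this]
    exact h.src_ne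
  rw [suppressRev_of_ne h1 h2]
  exact H.loopless d

/-- Suppression of a vertex of degree two. -/
noncomputable def suppress (H : EmbeddedGraph.{u}) (e : H.D) (h : H.IsSuppressible e) :
    EmbeddedGraph.{u} where
  V := {v : H.V // v ≠ H.src e}
  D := {d : H.D // H.src d ≠ H.src e}
  src d := ⟨H.src d.1, d.2⟩
  rev d := ⟨H.suppressRev e d.1, h.src_suppressRev_ne d.1⟩
  rev_rev d := Subtype.ext (h.suppressRev_suppressRev d.1 d.2)
  rev_ne d hd := h.src_suppressRev_ne_src d.1 (congrArg (fun x => H.src x.1) hd)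
  loopless d hd := h.src_suppressRev_ne_src d.1 (congrArg Subtype.val hd)
  next := H.next.subtypePerm fun d => by rw [H.src_next]
  sameCycle_next d e := by
    rw [Equiv.Perm.sameCycle_subtypePerm, H.sameCycle_next, Subtype.ext_iff]

open Classical in
theorem suppress_facePerm (h : H.IsSuppressible e) (d : (H.suppress e h).D) :
    ((H.suppress e h).facePerm d).1 =
      if H.src (H.facePerm d.1) = H.src e then H.facePerm (H.facePerm d.1) else H.facePerm d.1 := by
  have h0 : ((H.suppress e h).facePerm d).1 = H.next (H.suppressRev e d.1) := rfl
  rw [h0, H.src_facePerm]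
  by_cases h1 : H.rev d.1 = e
  · rw [suppressRev_of_eq h1, if_pos (by rw [h1]), H.facePerm_apply d.1, h1, H.facePerm_apply]
  by_cases h2 : H.rev d.1 = H.next e
  · rw [h.suppressRev_of_eq_next h2, if_pos (by rw [h2, H.src_next]), H.facePerm_apply d.1, h2,
      h.next_next, H.facePerm_apply]
  rw [suppressRev_of_ne h1 h2, if_neg fun h3 => (h.eq_or_eq h3).elim h1 h2, H.facePerm_apply]

theorem face_suppress_facePerm (h : H.IsSuppressible e) (d : (H.suppress e h).D) :
    H.face ((H.suppress e h).facePerm d).1 = H.face d.1 := by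
  rw [suppress_facePerm]
  split_ifs
  · rw [H.face_facePerm, H.face_facePerm]
  · rw [H.face_facePerm]

/-- One step of tracing after suppression is one or two old steps, whence the strong induction on
old steps. -/
theorem suppress_face_eq_iff (h : H.IsSuppressible e) (x y : (H.suppress e h).D) :
    (H.suppress e h).face x = (H.suppress e h).face y ↔ H.face x.1 = H.face y.1 := by
  rw [face_eq_iff]
  constructor
  · intro hxy
    obtain ⟨n, rfl⟩ := hxy.exists_nat_pow_eq
    induction n with
    | zero => rfl
    | succ n ih =>
      rw [pow_succ', Equiv.Perm.mul_apply, face_suppress_facePerm]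
      exact ih (Equiv.Perm.sameCycle_pow_right.2 (Equiv.Perm.SameCycle.refl _ _))
  · rw [face_eq_iff]
    intro hxy
    obtain ⟨n, hn⟩ := hxy.exists_nat_pow_eq
    induction n using Nat.strong_induction_on generalizing x with
    | _ n ih =>
      rcases Nat.eq_zero_or_pos n with rfl | hpos
      · rw [show x = y from Subtype.ext hn]
      obtain ⟨k, rfl⟩ : ∃ k, n = k + 1 := ⟨n - 1, by omega⟩
      rw [← Equiv.Perm.sameCycle_apply_left]
      rw [pow_succ, Equiv.Perm.mul_apply] at hn
      have hφ := suppress_facePerm h x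
      by_cases hc : H.src (H.facePerm x.1) = H.src e
      · rw [if_pos hc] at hφ
        rcases Nat.eq_zero_or_pos k with rfl | hk
        · exact absurd (hn ▸ hc) y.2
        obtain ⟨l, rfl⟩ : ∃ l, k = l + 1 := ⟨k - 1, by omega⟩
        rw [pow_succ, Equiv.Perm.mul_apply] at hn
        refine ih l (by omega) _ ?_ (by rw [hφ]; exact hn)
        rw [hφ]
        exact ⟨l, hn⟩
      · rw [if_neg hc] at hφ
        refine ih k (by omega) _ ?_ (by rw [hφ]; exact hn)
        rw [hφ]
        exact ⟨k, hn⟩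

/-- Suppressing a vertex of degree two does not change the faces. -/
noncomputable def suppressFaceEquiv (h : H.IsSuppressible e) : (H.suppress e h).Face ≃ H.Face :=
  Equiv.ofBijective
    (Quotient.lift (fun x : (H.suppress e h).D => H.face x.1) fun x y hxy =>
      (suppress_face_eq_iff h x y).1 (Quotient.sound hxy)) (by
    constructor
    · intro f g hfg
      obtain ⟨x, rfl⟩ := face_surjective _ f
      obtain ⟨y, rfl⟩ := face_surjective _ g
      exact (suppress_face_eq_iff h x y).2 hfg
    · intro f
      obtain ⟨d, rfl⟩ := H.face_surjective f
      by_cases hd : H.src d = H.src e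
      · refine ⟨(H.suppress e h).face ⟨H.facePerm d, ?_⟩, H.face_facePerm d⟩
        rw [H.src_facePerm, ← hd]
        exact H.loopless d
      · exact ⟨(H.suppress e h).face ⟨d, hd⟩, rfl⟩)

theorem suppressFaceEquiv_face (h : H.IsSuppressible e) (x : (H.suppress e h).D) :
    suppressFaceEquiv h ((H.suppress e h).face x) = H.face x.1 := rfl

theorem connected_suppress (h : H.IsSuppressible e) (hc : H.toSimple.Connected) :
    (H.suppress e h).toSimple.Connected := by
  classical
  -- The removed vertex is retracted onto one of its neighbours.
  let π : H.V → (H.suppress e h).V := fun v =>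
    if hv : v = H.src e then ⟨H.src (H.rev e), H.loopless e⟩ else ⟨v, hv⟩
  have hπ : ∀ v (hv : v ≠ H.src e), π v = ⟨v, hv⟩ := fun v hv => dif_neg hv
  have hπe : ∀ v, v = H.src e → π v = ⟨H.src (H.rev e), H.loopless e⟩ := fun v hv => dif_pos hv
  have hne : H.src (H.rev (H.next e)) ≠ H.src e := by
    rw [← H.src_next e]
    exact H.loopless _
  have hadj : (H.suppress e h).toSimple.Adj ⟨H.src (H.rev e), H.loopless e⟩
      ⟨H.src (H.rev (H.next e)), hne⟩ :=
    ⟨⟨H.rev e, H.loopless e⟩, rfl, Subtype.ext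
      (congrArg H.src (suppressRev_of_eq (H.rev_rev e)))⟩
  have hstart : ∀ d, H.src d = H.src e →
      (H.suppress e h).toSimple.Reachable (π (H.src d)) (π (H.src (H.rev d))) := by
    intro d hd
    rcases h.eq_or_eq hd with rfl | rfl
    · rw [hπe _ rfl, hπ _ (H.loopless _)]
      exact SimpleGraph.Reachable.refl _
    · rw [hπe _ hd, hπ _ hne]
      exact hadj.reachable
  have hstep : ∀ d, (H.suppress e h).toSimple.Reachable (π (H.src d)) (π (H.src (H.rev d))) := by
    intro d
    by_cases h1 : H.src d = H.src e
    · exact hstart d h1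
    by_cases h2 : H.src (H.rev d) = H.src e
    · have := hstart _ h2
      rw [H.rev_rev] at this
      exact this.symm
    rw [hπ _ h1, hπ _ h2]
    refine SimpleGraph.Adj.reachable ⟨⟨d, h1⟩, rfl, Subtype.ext (congrArg H.src (suppressRev_of_ne ?_ ?_))⟩
    · rintro h3
      exact h2 (by rw [h3])
    · rintro h3
      exact h2 (by rw [h3, H.src_next])
  have hreach : ∀ v w, H.toSimple.Reachable v w →
      (H.suppress e h).toSimple.Reachable (π v) (π w) := by
    intro v w hvw
    rw [SimpleGraph.reachable_iff_reflTransGen] at hvw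
    induction hvw with
    | refl => rfl
    | tail _ hadj ih =>
      obtain ⟨d, rfl, rfl⟩ := hadj
      exact ih.trans (hstep d)
  have : Nonempty (H.suppress e h).V := ⟨⟨H.src (H.rev e), H.loopless e⟩⟩
  refine ⟨fun v w => ?_⟩
  have := hreach v.1 w.1 (hc.preconnected _ _)
  rwa [hπ _ v.2, hπ _ w.2] at this

end

end EmbeddedGraph

namespace PlaneGraph

/-- A plane graph with a vertex of degree two is a subdivision of a smaller one, unless the two edges
at this vertex are parallel. -/
theorem exists_isEdgeSubdivision (H : PlaneGraph.{u}) {e : H.D} (h : H.IsSuppressible e)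
    (hn : ∀ d, H.next d ≠ d) :
    ∃ G : PlaneGraph.{u}, G.IsEdgeSubdivision H ∧ ∀ d, G.next d ≠ d := by
  classical
  let fV : Option (H.suppress e h).V ≃ H.V := Equiv.optionSubtypeNe (H.src e)
  let fD : (H.suppress e h).D ⊕ Bool ≃ H.D := Equiv.ofBijective
    (Sum.elim Subtype.val fun b => if b then H.next e else e) (by
      constructor
      · rintro (x | b) (y | c) hxy
        · exact congrArg Sum.inl (Subtype.ext hxy)
        · refine absurd ?_ x.2
          rw [show x.1 = _ from hxy]
          cases c
          · rfl
          · exact H.src_next e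
        · refine absurd ?_ y.2
          rw [show y.1 = _ from hxy.symm]
          cases b
          · rfl
          · exact H.src_next e
        · cases b <;> cases c
          · rfl
          · exact absurd hxy.symm h.next_ne
          · exact absurd hxy h.next_ne
          · rfl
      · intro d
        by_cases hd : H.src d = H.src e
        · rcases h.eq_or_eq hd with rfl | rfl
          · exact ⟨Sum.inr false, rfl⟩
          · exact ⟨Sum.inr true, rfl⟩
        · exact ⟨Sum.inl ⟨d, hd⟩, rfl⟩)
  have hcD : Nat.card H.D = Nat.card (H.suppress e h).D + 2 := by
    rw [← Nat.card_congr fD, Nat.card_sum]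
    simp
  have hcV : Nat.card H.V = Nat.card (H.suppress e h).V + 1 := by
    rw [← Nat.card_congr fV, Finite.card_option]
  have hcF := Nat.card_congr (EmbeddedGraph.suppressFaceEquiv h)
  let G : PlaneGraph.{u} :=
    { toEmbeddedGraph := H.suppress e h
      connected := EmbeddedGraph.connected_suppress h H.connected
      euler := by
        have h1 := H.card_darts_add
        have h2 := (H.suppress e h).card_darts
        omega
      outer := (EmbeddedGraph.suppressFaceEquiv h).symm H.outer }
  refine ⟨G, ⟨fV, fD, ⟨H.rev e, H.loopless e⟩, ?_, ?_, ?_, ?_, ?_, ?_, ?_, ?_⟩, ?_⟩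
  · intro x
    rfl
  · exact (Equiv.optionSubtypeNe_none (H.src e)).symm
  · exact (H.src_next e).trans (Equiv.optionSubtypeNe_none (H.src e)).symm
  · exact H.rev_rev e
  · change H.rev (H.suppressRev e (H.rev e)) = H.next e
    rw [EmbeddedGraph.suppressRev_of_eq (H.rev_rev e), H.rev_rev]
  · intro x hx hx'
    refine (EmbeddedGraph.suppressRev_of_ne (fun h1 => hx ?_) (fun h1 => hx' ?_)).symm
    · exact Subtype.ext ((H.rev_rev x.1).symm.trans (congrArg H.rev h1))
    · exact Subtype.ext (((H.rev_rev x.1).symm.trans (congrArg H.rev h1)).trans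
        (EmbeddedGraph.suppressRev_of_eq (H.rev_rev e)).symm)
  · intro x
    rfl
  · intro x
    change H.face x.1 = H.outer ↔
      (H.suppress e h).face x = (EmbeddedGraph.suppressFaceEquiv h).symm H.outer
    rw [Equiv.eq_symm_apply, EmbeddedGraph.suppressFaceEquiv_face]
  · intro d hd
    exact hn d.1 (congrArg Subtype.val hd)

end PlaneGraph

/-! ### Non-degenerate graphs are subdivisions of simple 3-connected ones -/

namespace PlaneGraph

theorem src_surjective (G : PlaneGraph.{u}) : Function.Surjective G.src := by
  intro w
  obtain ⟨d, -⟩ := G.face_surjective G.outer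
  have hw := G.connected.preconnected (G.src d) w
  rw [SimpleGraph.reachable_iff_reflTransGen] at hw
  cases hw with
  | refl => exact ⟨d, rfl⟩
  | tail _ h =>
    obtain ⟨e, -, rfl⟩ := h
    exact ⟨G.rev e, rfl⟩

section

variable {G : PlaneGraph.{u}}

/-- A vertex of degree at least three of a simple graph has three neighbours. -/
theorem exists_three_neighbours (h1 : ∀ d, G.next d ≠ d) (h2 : ∀ d, G.next (G.next d) ≠ d)
    (hs : G.IsSimple) (v : G.V) :
    ∃ T : Set G.V, T.ncard = 3 ∧ v ∉ T ∧ ∀ t ∈ T, ∃ d, G.src d = v ∧ G.src (G.rev d) = t := by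
  obtain ⟨d, rfl⟩ := G.src_surjective v
  have hne : ∀ a b, G.src a = G.src d → G.src b = G.src d → a ≠ b →
      G.src (G.rev a) ≠ G.src (G.rev b) :=
    fun a b ha hb hab h => hab (hs a b (ha.trans hb.symm) h)
  have s1 := G.src_next d
  have s2 := (G.src_next (G.next d)).trans s1
  refine ⟨{G.src (G.rev d), G.src (G.rev (G.next d)), G.src (G.rev (G.next (G.next d)))},
    ?_, ?_, ?_⟩
  · rw [Set.ncard_eq_three]
    exact ⟨_, _, _, hne _ _ rfl s1 (h1 d).symm, hne _ _ rfl s2 (h2 d).symm,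
      hne _ _ s1 s2 (h1 _).symm, rfl⟩
  · rintro (h | h | h)
    · exact G.loopless d h.symm
    · exact G.loopless _ (h.symm.trans s1.symm)
    · exact G.loopless _ (h.symm.trans s2.symm)
  · rintro t (rfl | rfl | rfl)
    · exact ⟨d, rfl, rfl⟩
    · exact ⟨_, s1, rfl⟩
    · exact ⟨_, s2, rfl⟩

theorem three_mul_ncard_le (h1 : ∀ d, G.next d ≠ d) (h2 : ∀ d, G.next (G.next d) ≠ d)
    (K : Set G.V) : 3 * K.ncard ≤ {d | G.src d ∈ K}.ncard := by
  choose r hr using G.src_surjective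
  have hs : ∀ (i : ℕ) d, G.src ((G.next ^ i) d) = G.src d := by
    intro i d
    induction i with
    | zero => rfl
    | succ i ih => rw [pow_succ', Equiv.Perm.mul_apply, G.src_next, ih]
  let F : K × Fin 3 → {d | G.src d ∈ K} := fun p =>
    ⟨(G.next ^ (p.2 : ℕ)) (r p.1), by
      rw [Set.mem_ofPred_eq, hs, hr]
      exact p.1.2⟩
  have hF : Function.Injective F := by
    rintro ⟨v, i⟩ ⟨w, j⟩ hij
    have h3 : (G.next ^ (i : ℕ)) (r v) = (G.next ^ (j : ℕ)) (r w) := congrArg Subtype.val hij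
    have hvw : v = w := by
      have := congrArg G.src h3
      rw [hs, hs, hr, hr] at this
      exact Subtype.ext this
    subst hvw
    have key : ∀ i j : ℕ, i < j → j < 3 → (G.next ^ i) (r v) ≠ (G.next ^ j) (r v) := by
      intro i j hij hj h
      have h' : (G.next ^ (j - i)) (r v) = r v := by
        apply (G.next ^ i).injective
        rw [← Equiv.Perm.mul_apply, ← pow_add, show i + (j - i) = j by omega, h]
      have hcases : j - i = 1 ∨ j - i = 2 := by omega
      rcases hcases with h'' | h'' <;> rw [h''] at h'
      · exact h1 _ h'
      · exact h2 _ h'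
    rcases lt_trichotomy (i : ℕ) j with hlt | heq | hlt
    · exact absurd h3 (key _ _ hlt j.2)
    · rw [Fin.ext heq]
    · exact absurd h3.symm (key _ _ hlt i.2)
  have := Nat.card_le_card_of_injective F hF
  rw [Nat.card_prod, Nat.card_fin, Nat.card_coe_set_eq, Nat.card_coe_set_eq] at this
  omega

/-- A part of the graph attached at two vertices, all of whose other vertices have degree at least
three, has at least as many edges as vertices. -/
theorem two_mul_ncard_src_le (h1 : ∀ d, G.next d ≠ d) (h2 : ∀ d, G.next (G.next d) ≠ d)
    (hs : G.IsSimple) {B : Set G.D} {K S : Set G.V} (hK : K.Nonempty)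
    (hS : S.ncard < 3) (hKS : Disjoint K S) (hr : ∀ d ∈ B, G.rev d ∈ B)
    (hKB : ∀ d, G.src d ∈ K → d ∈ B) (hB : ∀ d ∈ B, G.src d ∈ K ∨ G.src d ∈ S) :
    2 * (G.src '' B).ncard ≤ B.ncard := by
  -- A vertex of `K` has three neighbours, and `S` cannot contain them all.
  have hK2 : 2 ≤ K.ncard := by
    obtain ⟨v, hv⟩ := hK
    obtain ⟨T, hT3, hvT, hT⟩ := exists_three_neighbours h1 h2 hs v
    obtain ⟨t, htT, htS⟩ : ∃ t ∈ T, t ∉ S := by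
      by_contra! hcon
      have := Set.ncard_le_ncard hcon (Set.toFinite _)
      omega
    obtain ⟨d, hd, rfl⟩ := hT t htT
    have ht : G.src (G.rev d) ∈ K :=
      (hB _ (hr _ (hKB d (hd ▸ hv)))).resolve_right htS
    have hne : v ≠ G.src (G.rev d) := fun h => hvT (h ▸ htT)
    rw [← Set.ncard_pair hne]
    apply Set.ncard_le_ncard _ (Set.toFinite _)
    rintro w (rfl | rfl)
    · exact hv
    · exact ht
  have hK3 := three_mul_ncard_le h1 h2 K
  set B' : Set G.D := {d | d ∈ B ∧ G.src d ∈ S} with hB'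
  have e1 : {d | G.src d ∈ K}.ncard + B'.ncard ≤ B.ncard := by
    rw [← Set.ncard_union_eq _ (Set.toFinite _) (Set.toFinite _)]
    · apply Set.ncard_le_ncard _ (Set.toFinite _)
      rintro d (hd | hd)
      · exact hKB d hd
      · exact hd.1
    · rw [Set.disjoint_left]
      exact fun d hd hd' => Set.disjoint_left.1 hKS hd hd'.2
  have e2 : (G.src '' B).ncard ≤ K.ncard + (G.src '' B').ncard := by
    refine le_trans (Set.ncard_le_ncard ?_ (Set.toFinite _)) (Set.ncard_union_le _ _)
    rintro _ ⟨d, hd, rfl⟩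
    rcases hB d hd with h | h
    · exact Or.inl h
    · exact Or.inr ⟨d, ⟨hd, h⟩, rfl⟩
  have e3 : (G.src '' B').ncard ≤ B'.ncard := Set.ncard_image_le (Set.toFinite _)
  have e4 : (G.src '' B').ncard ≤ S.ncard := by
    apply Set.ncard_le_ncard _ (Set.toFinite _)
    rintro _ ⟨d, hd, rfl⟩
    exact hd.2
  -- With `s` attachment vertices used, `2 (|K| + s) ≤ 3 |K| + s` because `s ≤ 2 ≤ |K|`.
  omega

/-- If deleting `S` disconnects, the edges meeting one component `K` and all other edges form a
degenerate partition. -/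
theorem isThreeConnected_of_not_isDegenerate (h1 : ∀ d, G.next d ≠ d)
    (h2 : ∀ d, G.next (G.next d) ≠ d) (hs : G.IsSimple) (hdeg : ¬ G.IsDegenerate) :
    G.IsThreeConnected := by
  obtain ⟨d₀, -⟩ := G.face_surjective G.outer
  have hV : 4 ≤ Nat.card G.V := by
    obtain ⟨T, hT3, hvT, -⟩ := exists_three_neighbours h1 h2 hs (G.src d₀)
    have h3 := Set.ncard_insert_of_notMem hvT (Set.toFinite _)
    have h4 := Set.ncard_le_card (insert (G.src d₀) T)
    omega
  refine ⟨hV, fun S hS => ?_⟩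
  have hne : Nonempty (Sᶜ : Set G.V) := by
    have := Set.ncard_add_ncard_compl S
    exact (Set.nonempty_of_ncard_ne_zero (by omega)).to_subtype
  by_contra hcon
  have hpre : ¬ (G.toSimple.induce Sᶜ).Preconnected := fun h => hcon ⟨h⟩
  simp only [SimpleGraph.Preconnected, not_forall] at hpre
  obtain ⟨a, b, hab⟩ := hpre
  set K : Set G.V := {w | ∃ hw : w ∈ Sᶜ, (G.toSimple.induce Sᶜ).Reachable a ⟨w, hw⟩} with hK
  have hKS : Disjoint K S := Set.disjoint_left.2 fun w hw hwS => hw.1 hwS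
  have hclosed : ∀ d, G.src (G.rev d) ∈ K → G.src d ∈ K ∨ G.src d ∈ S := by
    rintro d ⟨hw, hreach⟩
    by_cases hd : G.src d ∈ S
    · exact Or.inr hd
    · refine Or.inl ⟨hd, hreach.trans (SimpleGraph.Adj.reachable ?_)⟩
      exact ⟨G.rev d, rfl, by rw [G.rev_rev]; rfl⟩
  set A : Set G.D := {d | G.src d ∈ K ∨ G.src (G.rev d) ∈ K} with hA
  have hAr : ∀ d, G.rev d ∈ A ↔ d ∈ A := by
    intro d
    simp only [hA, Set.mem_ofPred_eq, G.rev_rev]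
    exact or_comm
  have hAmem : ∀ d ∈ A, G.src d ∈ K ∨ G.src d ∈ S := by
    rintro d (hd | hd)
    · exact Or.inl hd
    · exact hclosed d hd
  have haK : a.1 ∈ K := ⟨a.2, SimpleGraph.Reachable.refl _⟩
  have hbK : b.1 ∉ K := fun h => hab h.2
  obtain ⟨x, y, hxy⟩ : ∃ x y, S ⊆ {x, y} := by
    have hcases : S.ncard = 0 ∨ S.ncard = 1 ∨ S.ncard = 2 := by omega
    rcases hcases with h | h | h
    · rw [Set.ncard_eq_zero (Set.toFinite _)] at h
      exact ⟨G.src d₀, G.src d₀, by simp [h]⟩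
    · obtain ⟨x, rfl⟩ := Set.ncard_eq_one.1 h
      exact ⟨x, x, by simp⟩
    · obtain ⟨x, y, -, rfl⟩ := Set.ncard_eq_two.1 h
      exact ⟨x, y, subset_rfl⟩
  have hcK : ∀ d, G.src d ∈ (K ∪ S)ᶜ → d ∉ A := by
    intro d hd hdA
    exact hd (hAmem d hdA)
  refine hdeg ⟨A, x, y, ⟨hAr, fun d hd e he hde => ?_⟩, ?_, ?_, ?_, ?_⟩
  · have hdS : G.src d ∈ S := (hAmem d hd).resolve_left fun h => he (Or.inl (hde ▸ h))
    exact hxy hdS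
  · obtain ⟨d, hd⟩ := G.src_surjective a
    exact ⟨d, Or.inl (hd ▸ haK)⟩
  · obtain ⟨d, hd⟩ := G.src_surjective b
    exact ⟨d, hcK d fun h => h.elim (hd ▸ hbK) (hd ▸ b.2)⟩
  · exact two_mul_ncard_src_le h1 h2 hs ⟨_, haK⟩ hS hKS (fun d hd => (hAr d).2 hd)
      (fun d hd => Or.inl hd) hAmem
  · refine two_mul_ncard_src_le h1 h2 hs (K := (K ∪ S)ᶜ) ⟨b.1, fun h => h.elim hbK b.2⟩ hS ?_
      (fun d hd h => hd ((hAr d).1 h)) hcK fun d hd => ?_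
    · exact Set.disjoint_left.2 fun w hw hwS => hw (Or.inr hwS)
    · by_cases hdS : G.src d ∈ S
      · exact Or.inr hdS
      · exact Or.inl fun h => h.elim (fun h' => hd (Or.inl h')) hdS

end

/-- Suppressing all vertices of degree two turns a plane graph without degenerate 2-separations into
a simple 3-connected one. -/
theorem exists_isSubdivisionOf (G : PlaneGraph.{u}) (hF : 4 ≤ Nat.card G.Face)
    (hn : ∀ d, G.next d ≠ d) (hdeg : ¬ G.IsDegenerate) :
    ∃ R : PlaneGraph.{u}, R.IsSimple ∧ R.IsThreeConnected ∧ G.IsSubdivisionOf R := by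
  induction hc : Nat.card G.D using Nat.strong_induction_on generalizing G with
  | _ n ih =>
    by_cases h2 : ∀ d, G.next (G.next d) ≠ d
    · have hs : G.IsSimple := by
        intro d e hde hde'
        by_contra hne
        exact hdeg (G.isDegenerate_of_parallel hF hne hde hde')
      exact ⟨G, hs, isThreeConnected_of_not_isDegenerate hn h2 hs hdeg, .refl⟩
    · push Not at h2
      obtain ⟨e, he⟩ := h2
      have hsup : G.IsSuppressible e := ⟨he, hn e, fun h =>
        hdeg (G.isDegenerate_of_parallel hF (hn e).symm (G.src_next e).symm h)⟩
      obtain ⟨G', hG', hn'⟩ := G.exists_isEdgeSubdivision hsup hn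
      obtain ⟨c1, c2⟩ := hG'.card
      -- Suppression loses two darts and no face; a degenerate `G'` would make `G` degenerate.
      obtain ⟨R, hR, hR', hsub⟩ := ih (Nat.card G'.D) (by omega) G' (by omega) hn'
        (fun h => hdeg (h.of_isEdgeSubdivision hG')) rfl
      exact ⟨R, hR, hR', hsub.tail hG'⟩

end PlaneGraph

theorem theorem2 (G : PlaneGraph.{u}) (hG : G.IsTwoConnected) (hF : 4 ≤ Nat.card G.Face) :
    (∃ R : PlaneGraph.{u}, R.IsSimple ∧ R.IsThreeConnected ∧ G.IsSubdivisionOf R) ∨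
      ∃ C : Cycle G.D, G.IsSeparatingCycle C ∧ C.length ≤ G.maxFaceDegree := by
  have hn := G.next_ne_of_isTwoConnected hG (by omega)
  by_cases hdeg : G.IsDegenerate
  · exact Or.inr (hdeg.hasShortSeparatingCycle hG hn)
  · exact Or.inl (G.exists_isSubdivisionOf hF hn hdeg)
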